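/- Let $\mathcal C$ be the ternary Cantor set and $E=\mathcal C^3\subset\mathbb R^3$. For $i\in\{0,1\}^3$ let $S_i(x)=\tfrac13x+\tfrac23 i$; the eight cubes $D_i=S_i([0,1]^3)$ are the basic sets of level 1. Let $s=\dim_{\rm H}E$ $(=3\log_3 2)$, let $\mu(A)=\mathcal H^s(A\cap E)/\mathcal H^s(E)$, let $c=\min_{i\ne j} d(S_i(E),S_j(E))$, and write $|A|$ for the Euclidean diameter of $A$. Call a convex set $A\subset\mathbb R^3$ with $c\le|A|\le|E|$ an optimal set of $\mathcal C^3$ if it minimizes $|A|^s/\mu(A)$ (understood as $+\infty$ if $\mu(A)=0$) among all such convex sets. Then: 1. There is an optimal set of $\mathcal C^3$ that meets at least five of the eight basic sets of level 1. 2. Every optimal set that meets at least two basic sets of level 1 meets at least five of them (in particular at least four). 3. If an optimal set $A$ meets fewer than two basic sets of level 1, then there is an $i$ with $A\cap E\subset D_i$ such that the magnified set $S_i^{-1}(A)$ is again optimal and meets at least five basic sets of level 1. -/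

import Mathlib

open MeasureTheory
open scoped ENNReal

noncomputable section

/-- The `d`-fold Cartesian product of the ternary Cantor set, in Euclidean space. -/
def cantorProd (d : ℕ) : Set (EuclideanSpace ℝ (Fin d)) :=
  {x | ∀ k, x k ∈ cantorSet}

/-- The similarity `x ↦ x / 3 + (2 / 3) i` attached to a vertex `i ∈ {0, 1}ᵈ`. -/
def cantorMap (d : ℕ) (i : Fin d → Fin 2) (x : EuclideanSpace ℝ (Fin d)) :
    EuclideanSpace ℝ (Fin d) :=
  (1 / 3 : ℝ) • x + (2 / 3 : ℝ) • WithLp.toLp 2 (fun k => ((i k : ℕ) : ℝ))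

/-- The closed unit cube `[0, 1]ᵈ`. -/
def unitCube (d : ℕ) : Set (EuclideanSpace ℝ (Fin d)) :=
  {x | ∀ k, x k ∈ Set.Icc (0 : ℝ) 1}

/-- The basic sets of level 1: the cubes `S_i([0, 1]ᵈ)`. -/
def basicCube (d : ℕ) (i : Fin d → Fin 2) : Set (EuclideanSpace ℝ (Fin d)) :=
  cantorMap d i '' unitCube d

/-- The Hausdorff dimension `s` of the `d`-fold product of the Cantor set. -/
def cantorDim (d : ℕ) : ℝ := (dimH (cantorProd d)).toReal

/-- The normalized Hausdorff measure `μ(A) = ℋˢ(A ∩ E) / ℋˢ(E)` with `E` the `d`-fold product of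
the Cantor set (as an outer measure, so for every set `A`). -/
def cantorMeasure (d : ℕ) (A : Set (EuclideanSpace ℝ (Fin d))) : ℝ≥0∞ :=
  μH[cantorDim d] (A ∩ cantorProd d) / μH[cantorDim d] (cantorProd d)

/-- The distance `inf {dist x y : x ∈ X, y ∈ Y}` between two sets. -/
def setDist {M : Type*} [MetricSpace M] (X Y : Set M) : ℝ :=
  sInf {r | ∃ x ∈ X, ∃ y ∈ Y, r = dist x y}

/-- The constant `c = min_{i ≠ j} d(S_i(E), S_j(E))`. -/
def cantorGap (d : ℕ) : ℝ :=
  ⨅ p : {p : (Fin d → Fin 2) × (Fin d → Fin 2) // p.1 ≠ p.2},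
    setDist (cantorMap d p.1.1 '' cantorProd d) (cantorMap d p.1.2 '' cantorProd d)

/-- The competitors: convex sets `A` with `c ≤ |A| ≤ |E|`, where `|·|` is the diameter. -/
def admissibleSets (d : ℕ) : Set (Set (EuclideanSpace ℝ (Fin d))) :=
  {A | Convex ℝ A ∧ ENNReal.ofReal (cantorGap d) ≤ Metric.ediam A ∧
    Metric.ediam A ≤ Metric.ediam (cantorProd d)}

/-- The quotient `|A|ˢ / μ(A)`; it is `∞` when `μ(A) = 0 < |A|`. -/
def diamRatio (d : ℕ) (A : Set (EuclideanSpace ℝ (Fin d))) : ℝ≥0∞ :=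
  Metric.ediam A ^ cantorDim d / cantorMeasure d A

/-- An optimal set is an admissible set at which `|A|ˢ / μ(A)` attains its minimum. -/
def IsOptimalSet (d : ℕ) (A : Set (EuclideanSpace ℝ (Fin d))) : Prop :=
  A ∈ admissibleSets d ∧ IsMinOn (diamRatio d) (admissibleSets d) A

/-- The number of level-1 basic sets which `A` intersects. -/
def numBasicMet (d : ℕ) (A : Set (EuclideanSpace ℝ (Fin d))) : ℕ :=
  Set.ncard {i : Fin d → Fin 2 | (A ∩ basicCube d i).Nonempty}

end

/-! Let `E` be the dust and `s = log_3 8`. A ball about the centre of the unit cube, of diameter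
`testDiam`, has mass at least 453/512, so every optimal set of diameter `D` satisfies `D^s ≤
testDiam^s · (512/453) · μ(A)`. The combinatorial core uses nothing else about optimality.

Each of the eight cubes is cut into 64 cells of level 3, each of mass at most 1/512. If `A ∩ E`
meets `m` cells, the inequality bounds `t = 729 D²`, the squared diameter in units of 1/27, from
above (`MassBound`). Conversely, `t < T` forbids cells of different cubes from both lying far out,
and a finite enumeration turns this into a bound on `m` (`PairBound`, `TripleBound`). Alternating
the two bounds drives `t` below the squared gap of the cubes, 81 across a face and 162 across a
diagonal. Hence `A ∩ E` cannot meet exactly two, three or four cubes (`false_of_numBasicMet`). The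
cases are two cubes sharing a face, a diagonal pair, three cubes, and four cubes, which either split
into two diagonal pairs or form a claw, that is, a cube with its three neighbours; the claw is the
hardest.

If `A ∩ E` lies in one cube, magnification by 3 multiplies both `D^s` and the mass by 8 and keeps
the quotient. The magnified diameter is at least 1, too large for a set whose trace again lies in
one cube, so the magnified trace meets at least five cubes (`magnify`). When `A` itself reaches a
second cube, its small diameter pushes the trace to one side of its cube, and the magnified trace
would meet at most four cubes; this excludes the mixed case.

A minimizer exists by compactness: diameters converge along an ultrafilter limit, and mass cannot
drop. The value of `s` comes from the Cantor function (positive measure) and from the natural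
coverings (finite measure). -/

/-! ### Planar cell patterns in diagonal squares and in `L`-shapes -/

/-- The left endpoints `0, 2, 6, 8` (in units of `1 / 27`) of the four triadic intervals of
length `1 / 27` in a third of the Cantor set. -/
def cellOffset (j : ℕ) : ℕ := 2 * j + 2 * (j / 2)

theorem cellOffset_mono : Monotone cellOffset := by
  intro a b h
  simp only [cellOffset]
  omega

/-- A lower bound for the squared distance of two cells, of offsets `(a, b)` and `(c, d)`, in
diagonally opposite squares. -/
def diagSq (a b c d : ℕ) : ℕ :=
  (9 + cellOffset a + cellOffset c) ^ 2 + (9 + cellOffset b + cellOffset d) ^ 2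

theorem diagSq_mono {a b c d a' b' c' d' : ℕ} (ha : a ≤ a') (hb : b ≤ b') (hc : c ≤ c')
    (hd : d ≤ d') : diagSq a b c d ≤ diagSq a' b' c' d' := by
  have := cellOffset_mono ha
  have := cellOffset_mono hb
  have := cellOffset_mono hc
  have := cellOffset_mono hd
  unfold diagSq
  gcongr

/-- The cells compatible, at squared distance less than `T`, with every cell below the
profile `h`, whose second index is less than `e`. -/
def partnerCells (T : ℕ) (h : Fin 4 → ℕ) (e : ℕ) : Finset (Fin 4 × Fin 4) :=
  Finset.univ.filter fun c => c.2.val < e ∧ ∀ a : Fin 4, h a = 0 ∨ diagSq a (h a - 1) c.1 c.2 < T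

/-- `g` bounds the number of cells in two diagonally opposite squares. -/
def PairBound (T g : ℕ) : Prop :=
  ∀ h₀ h₁ h₂ h₃ : Fin 5, h₁ ≤ h₀ → h₂ ≤ h₁ → h₃ ≤ h₂ → 0 < h₀.val →
    (0, 0) ∈ partnerCells T ![h₀.val, h₁.val, h₂.val, h₃.val] 4 →
    h₀ + h₁ + h₂ + h₃ + (partnerCells T ![h₀.val, h₁.val, h₂.val, h₃.val] 4).card ≤ g

instance (T g : ℕ) : Decidable (PairBound T g) := by
  unfold PairBound; infer_instance

/-- The cells of the corner square compatible with horizontal extent `w` and vertical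
extent `e` of its two neighbours. -/
def cornerCells (T w e : ℕ) : Finset (Fin 4 × Fin 4) :=
  Finset.univ.filter fun c =>
    (9 + cellOffset c.1 + cellOffset (w - 1)) ^ 2 < T ∧
      (9 + cellOffset c.2 + cellOffset (e - 1)) ^ 2 < T

/-- `m` bounds the number of cells in three squares in `L`-shape. -/
def TripleBound (T m : ℕ) : Prop :=
  ∀ h₀ h₁ h₂ h₃ : Fin 5, h₁ ≤ h₀ → h₂ ≤ h₁ → h₃ ≤ h₂ → 0 < h₀.val →
    (0, 0) ∈ partnerCells T ![h₀.val, h₁.val, h₂.val, h₃.val] 4 →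
    ∀ e : Fin 5, 0 < e.val →
    (cornerCells T (1 + min h₁.val 1 + min h₂.val 1 + min h₃.val 1) e).card +
      (h₀.val + h₁ + h₂ + h₃) +
        (partnerCells T ![h₀.val, h₁.val, h₂.val, h₃.val] e).card ≤ m

instance (T m : ℕ) : Decidable (TripleBound T m) := by
  unfold TripleBound; infer_instance

/-- The height over the index `a` of the least decreasing profile containing `F`. -/
def profile (F : Finset (Fin 4 × Fin 4)) (a : Fin 4) : ℕ :=
  (F.filter fun x => a ≤ x.1).sup fun x => x.2.val + 1

theorem profile_lt_five (F : Finset (Fin 4 × Fin 4)) (a : Fin 4) : profile F a < 5 := by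
  rw [profile, Finset.sup_lt_iff (by simp)]
  intro x _
  omega

theorem profile_antitone (F : Finset (Fin 4 × Fin 4)) : Antitone (profile F) := by
  intro a b h
  refine Finset.sup_mono fun x hx => ?_
  rw [Finset.mem_filter] at hx ⊢
  exact ⟨hx.1, h.trans hx.2⟩

theorem lt_profile {F : Finset (Fin 4 × Fin 4)} {x : Fin 4 × Fin 4} (hx : x ∈ F) {a : Fin 4}
    (ha : a ≤ x.1) : x.2.val < profile F a :=
  Finset.le_sup (f := fun x : Fin 4 × Fin 4 => x.2.val + 1) (Finset.mem_filter.2 ⟨hx, ha⟩)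

theorem exists_mem_profile {F : Finset (Fin 4 × Fin 4)} {a : Fin 4} (ha : profile F a ≠ 0) :
    ∃ x ∈ F, a ≤ x.1 ∧ x.2.val = profile F a - 1 := by
  have hne : (F.filter fun x => a ≤ x.1).Nonempty := by
    rw [Finset.nonempty_iff_ne_empty]
    rintro h
    exact ha (by simp [profile, h])
  obtain ⟨x, hx, h⟩ := Finset.exists_mem_eq_sup _ hne fun x : Fin 4 × Fin 4 => x.2.val + 1
  rw [Finset.mem_filter] at hx
  exact ⟨x, hx.1, hx.2, by rw [profile, h]; rfl⟩

/-- Each column of `F` lies below the staircase, so the area of the staircase bounds the number of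
cells. -/
theorem card_le_sum_profile (F : Finset (Fin 4 × Fin 4)) : F.card ≤ ∑ a, profile F a := by
  rw [Finset.card_eq_sum_card_fiberwise (f := Prod.fst) (t := Finset.univ) (by simp)]
  refine Finset.sum_le_sum fun a _ => ?_
  rw [← Finset.card_range (profile F a)]
  refine Finset.card_le_card_of_injOn (fun x => x.2.val) ?_ ?_
  · intro x hx
    simp only [Finset.coe_filter, Set.mem_ofPred_eq] at hx
    simpa using lt_profile hx.1 hx.2.ge
  · intro x hx y hy h
    simp only [Finset.coe_filter, Set.mem_ofPred_eq] at hx hy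
    exact Prod.ext (hx.2.trans hy.2.symm) (Fin.ext h)

theorem vec_profile (F : Finset (Fin 4 × Fin 4)) :
    ![profile F 0, profile F 1, profile F 2, profile F 3] = profile F := by
  funext a
  fin_cases a <;> rfl

section Partner

variable {T : ℕ} {F G : Finset (Fin 4 × Fin 4)}

/-- Since `diagSq` is monotone, compatibility with the staircase over `F` need only be tested at the
top of each column, and each such top cell is dominated by a genuine cell of `F`. -/
theorem subset_partnerCells (h : ∀ x ∈ F, ∀ y ∈ G, diagSq x.1 x.2 y.1 y.2 < T) {e : ℕ}
    (he : ∀ y ∈ G, y.2.val < e) : G ⊆ partnerCells T (profile F) e := by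
  intro y hy
  refine Finset.mem_filter.2 ⟨Finset.mem_univ _, he y hy, fun a => ?_⟩
  by_cases ha : profile F a = 0
  · exact Or.inl ha
  · obtain ⟨x, hx, hax, hx2⟩ := exists_mem_profile ha
    refine Or.inr (lt_of_le_of_lt ?_ (h x hx y hy))
    rw [← hx2]
    exact diagSq_mono hax le_rfl le_rfl le_rfl

theorem profile_zero_pos (hF : F.Nonempty) : 0 < profile F 0 := by
  obtain ⟨x, hx⟩ := hF
  exact (Nat.zero_le _).trans_lt (lt_profile hx (Fin.zero_le _))

/-- This expresses the nonemptiness of `G` through the profile of `F` alone, so that the enumeration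
can discard profiles without partners. -/
theorem zero_mem_partnerCells (hG : G.Nonempty)
    (h : ∀ x ∈ F, ∀ y ∈ G, diagSq x.1 x.2 y.1 y.2 < T) : (0, 0) ∈ partnerCells T (profile F) 4 := by
  obtain ⟨y, hy⟩ := hG
  have hy' := (Finset.mem_filter.1 (subset_partnerCells h (e := 4) (fun y _ => y.2.isLt) hy)).2.2
  exact Finset.mem_filter.2 ⟨Finset.mem_univ _, Nat.succ_pos _, fun a => (hy' a).imp_right fun H =>
    (diagSq_mono le_rfl le_rfl (Nat.zero_le _) (Nat.zero_le _)).trans_lt H⟩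

/-- Passing to the staircase hull reduces all pairs of sets to at most 70 decreasing profiles. -/
theorem PairBound.card_add_card_le {g : ℕ} (hb : PairBound T g) (hF : F.Nonempty)
    (hG : G.Nonempty) (h : ∀ x ∈ F, ∀ y ∈ G, diagSq x.1 x.2 y.1 y.2 < T) :
    F.card + G.card ≤ g := by
  have key := hb ⟨_, profile_lt_five F 0⟩ ⟨_, profile_lt_five F 1⟩ ⟨_, profile_lt_five F 2⟩
    ⟨_, profile_lt_five F 3⟩ (profile_antitone F (by decide)) (profile_antitone F (by decide))
    (profile_antitone F (by decide)) (profile_zero_pos hF)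
    (by simpa only [vec_profile] using zero_mem_partnerCells hG h)
  simp only [vec_profile] at key
  have h1 := card_le_sum_profile F
  have h2 := Finset.card_le_card (subset_partnerCells h (e := 4) fun y _ => y.2.isLt)
  rw [Fin.sum_univ_four] at h1
  omega

theorem TripleBound.card_add_card_add_card_le {m : ℕ} (hb : TripleBound T m)
    {O : Finset (Fin 4 × Fin 4)} (hF : F.Nonempty) (hG : G.Nonempty)
    (h : ∀ x ∈ F, ∀ y ∈ G, diagSq x.1 x.2 y.1 y.2 < T)
    (hOF : ∀ z ∈ O, ∀ x ∈ F, (9 + cellOffset z.1 + cellOffset x.1) ^ 2 < T)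
    (hOG : ∀ z ∈ O, ∀ y ∈ G, (9 + cellOffset z.2 + cellOffset y.2) ^ 2 < T) :
    O.card + F.card + G.card ≤ m := by
  obtain ⟨y, hy, hymax⟩ := G.exists_max_image (fun y => y.2) hG
  obtain ⟨x, hx, hxmax⟩ := F.exists_max_image (fun x => x.1) hF
  have key := hb ⟨_, profile_lt_five F 0⟩ ⟨_, profile_lt_five F 1⟩ ⟨_, profile_lt_five F 2⟩
    ⟨_, profile_lt_five F 3⟩ (profile_antitone F (by decide)) (profile_antitone F (by decide))
    (profile_antitone F (by decide)) (profile_zero_pos hF)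
    (by simpa only [vec_profile] using zero_mem_partnerCells hG h)
    ⟨y.2.val + 1, by omega⟩ (Nat.succ_pos _)
  simp only [vec_profile] at key
  -- The left side counts the nonempty columns of the staircase, which is one more than the largest
  -- first index in `F`.
  have hw : 1 + min (profile F 1) 1 + min (profile F 2) 1 + min (profile F 3) 1 = x.1.val + 1 := by
    have pos : ∀ a ≤ x.1, 0 < profile F a := fun a ha => (Nat.zero_le _).trans_lt (lt_profile hx ha)
    have zero : ∀ a, x.1 < a → profile F a = 0 := by
      intro a ha
      by_contra hne
      obtain ⟨z, hz, haz, -⟩ := exists_mem_profile hne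
      exact absurd (hxmax z hz) (not_le.2 (ha.trans_le haz))
    obtain ⟨i, hi⟩ : ∃ i, x.1 = i := ⟨_, rfl⟩
    rw [hi] at pos zero ⊢
    fin_cases i
    · simp [zero 1 (by decide), zero 2 (by decide), zero 3 (by decide)]
    · simp [zero 2 (by decide), zero 3 (by decide), Nat.min_eq_right (pos 1 (by decide))]
    · simp [zero 3 (by decide), Nat.min_eq_right (pos 1 (by decide)),
        Nat.min_eq_right (pos 2 (by decide))]
    · simp [Nat.min_eq_right (pos 1 (by decide)), Nat.min_eq_right (pos 2 (by decide)),
        Nat.min_eq_right (pos 3 (by decide))]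
  rw [hw] at key
  have hO : O ⊆ cornerCells T (x.1.val + 1) (y.2.val + 1) := fun z hz =>
    Finset.mem_filter.2 ⟨Finset.mem_univ _, hOF z hz x hx, hOG z hz y hy⟩
  have h1 := card_le_sum_profile F
  have h2 := Finset.card_le_card (subset_partnerCells h (e := y.2.val + 1)
    fun z hz => Nat.lt_succ_of_le (hymax z hz))
  have h3 := Finset.card_le_card hO
  rw [Fin.sum_univ_four] at h1
  omega

end Partner

/-! ### Finite tables of cell bounds -/

/-- The thresholds `T` are the ones that `MassBound` supplies along the descending chains below. -/
theorem pairBound_883 : PairBound 883 26 := by decide +kernel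
theorem pairBound_752 : PairBound 752 22 := by decide +kernel
theorem pairBound_666 : PairBound 666 19 := by decide +kernel
theorem pairBound_602 : PairBound 602 18 := by decide +kernel
theorem pairBound_538 : PairBound 538 16 := by decide +kernel
theorem pairBound_509 : PairBound 509 15 := by decide +kernel
theorem pairBound_460 : PairBound 460 14 := by decide +kernel
theorem pairBound_439 : PairBound 439 13 := by decide +kernel
theorem pairBound_418 : PairBound 418 13 := by decide +kernel
theorem pairBound_369 : PairBound 369 9 := by decide +kernel
theorem pairBound_348 : PairBound 348 9 := by decide +kernel
theorem pairBound_334 : PairBound 334 7 := by decide +kernel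
theorem pairBound_307 : PairBound 307 7 := by decide +kernel
theorem pairBound_286 : PairBound 286 6 := by decide +kernel
theorem pairBound_204 : PairBound 204 4 := by decide +kernel

theorem tripleBound_883 : TripleBound 883 42 := by decide +kernel
theorem tripleBound_752 : TripleBound 752 38 := by decide +kernel
theorem tripleBound_666 : TripleBound 666 35 := by decide +kernel
theorem tripleBound_602 : TripleBound 602 31 := by decide +kernel
theorem tripleBound_538 : TripleBound 538 30 := by decide +kernel
theorem tripleBound_509 : TripleBound 509 27 := by decide +kernel
theorem tripleBound_460 : TripleBound 460 26 := by decide +kernel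
theorem tripleBound_439 : TripleBound 439 25 := by decide +kernel
theorem tripleBound_418 : TripleBound 418 25 := by decide +kernel
theorem tripleBound_369 : TripleBound 369 24 := by decide +kernel
theorem tripleBound_348 : TripleBound 348 21 := by decide +kernel
theorem tripleBound_334 : TripleBound 334 20 := by decide +kernel
theorem tripleBound_307 : TripleBound 307 20 := by decide +kernel
theorem tripleBound_286 : TripleBound 286 13 := by decide +kernel
theorem tripleBound_204 : TripleBound 204 8 := by decide +kernel

/-! ### Alternating mass and geometry -/

/-- Mass bounds `m` for a set force upper bounds for its rescaled squared diameter `t`. -/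
def MassBound (t : ℝ) (m : ℕ) : Prop :=
  ∀ M T : ℕ, m ≤ M → 9 * T ≤ 14515 → M ^ 56 * 14515 ^ 53 < (9 * T) ^ 53 * 453 ^ 56 → t < T

theorem MassBound.false_of_diagonal {t : ℝ} {m : ℕ} (hm : MassBound t m) (h256 : m ≤ 256)
    (ht : 162 ≤ t) (h : ∀ T g : ℕ, PairBound T g → t < T → m ≤ 8 * g) : False := by
  -- The value 256 allows two diagonal pairs with 64 cells per cube. Each step turns a count into a
  -- threshold for `t` and back, with counts 208, 176, 144, 120, 104, 72, 48; the last one gives `t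
  -- < 162`.
  have h1 := h _ _ pairBound_883 (hm 256 883 h256 (by norm_num) (by norm_num))
  have h2 := h _ _ pairBound_752 (hm _ 752 h1 (by norm_num) (by norm_num))
  have h3 := h _ _ pairBound_602 (hm _ 602 h2 (by norm_num) (by norm_num))
  have h4 := h _ _ pairBound_509 (hm _ 509 h3 (by norm_num) (by norm_num))
  have h5 := h _ _ pairBound_418 (hm _ 418 h4 (by norm_num) (by norm_num))
  have h6 := h _ _ pairBound_348 (hm _ 348 h5 (by norm_num) (by norm_num))
  have h7 := h _ _ pairBound_286 (hm _ 286 h6 (by norm_num) (by norm_num))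
  have h8 := hm _ 162 h7 (by norm_num) (by norm_num)
  norm_num at h8
  linarith

theorem MassBound.false_of_triple {t : ℝ} {m : ℕ} (hm : MassBound t m) (h192 : m ≤ 192)
    (ht : 162 ≤ t) (h : ∀ T g : ℕ, TripleBound T g → t < T → m ≤ 4 * g) : False := by
  -- Start from three full cubes, 192 = 3 · 64; the counts descend through 140, 108, 96, 80, 52, 32.
  have h1 := h _ _ tripleBound_666 (hm 192 666 h192 (by norm_num) (by norm_num))
  have h2 := h _ _ tripleBound_509 (hm _ 509 h1 (by norm_num) (by norm_num))
  have h3 := h _ _ tripleBound_369 (hm _ 369 h2 (by norm_num) (by norm_num))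
  have h4 := h _ _ tripleBound_334 (hm _ 334 h3 (by norm_num) (by norm_num))
  have h5 := h _ _ tripleBound_286 (hm _ 286 h4 (by norm_num) (by norm_num))
  have h6 := h _ _ tripleBound_204 (hm _ 204 h5 (by norm_num) (by norm_num))
  have h8 := hm _ 162 h6 (by norm_num) (by norm_num)
  norm_num at h8
  linarith

/-! ### Spatial cells and the claw configuration -/

/-- The projection of a set of cells of a cube to the plane of the coordinates `p` and `q`. -/
def planeCells (p q : Fin 3) (S : Finset (Fin 3 → Fin 4)) : Finset (Fin 4 × Fin 4) :=
  S.image fun c => (c p, c q)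

/-- The fibres of the projection are rows of four cells in the third direction. -/
theorem card_le_four_mul_planeCells {p q : Fin 3} (hpq : p ≠ q) (S : Finset (Fin 3 → Fin 4)) :
    S.card ≤ 4 * (planeCells p q S).card := by
  refine Finset.card_le_mul_card_image S 4 fun b _ => ?_
  obtain ⟨r, hr⟩ : ∃ r : Fin 3, ∀ k, k = p ∨ k = q ∨ k = r := by
    clear * - hpq; revert p q; decide
  refine (Finset.card_le_card_of_injOn (t := (Finset.univ : Finset (Fin 4))) (fun c => c r)
    (fun _ _ => Finset.mem_coe.2 (Finset.mem_univ _)) ?_).trans_eq (by simp)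
  intro c hc d hd h
  simp only [Finset.coe_filter, Set.mem_ofPred_eq] at hc hd
  have h1 := congrArg Prod.fst (hc.2.trans hd.2.symm)
  have h2 := congrArg Prod.snd (hc.2.trans hd.2.symm)
  funext k
  rcases hr k with rfl | rfl | rfl
  exacts [h1, h2, h]

section Cells

variable {t : ℝ} {T : ℕ} {p q r : Fin 3} {O X Y Z : Finset (Fin 3 → Fin 4)}

theorem PairBound.card_cells_le {g : ℕ} (hb : PairBound T g) (ht : t < T) (hpq : p ≠ q)
    (hX : X.Nonempty) (hY : Y.Nonempty)
    (h : ∀ x ∈ X, ∀ y ∈ Y, (diagSq (x p) (x q) (y p) (y q) : ℝ) ≤ t) :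
    X.card + Y.card ≤ 4 * g := by
  have h1 := card_le_four_mul_planeCells hpq X
  have h2 := card_le_four_mul_planeCells hpq Y
  have h3 := hb.card_add_card_le (F := planeCells p q X) (G := planeCells p q Y)
    (hX.image _) (hY.image _) (by
      simp only [planeCells, Finset.forall_mem_image]
      intro x hx y hy
      exact_mod_cast (h x hx y hy).trans_lt ht)
  omega

theorem TripleBound.card_cells_le {g : ℕ} (hb : TripleBound T g) (ht : t < T) (hpq : p ≠ q)
    (hX : X.Nonempty) (hY : Y.Nonempty)
    (h : ∀ x ∈ X, ∀ y ∈ Y, (diagSq (x p) (x q) (y p) (y q) : ℝ) ≤ t)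
    (hOX : ∀ o ∈ O, ∀ x ∈ X, (9 + cellOffset (o p) + cellOffset (x p) : ℝ) ^ 2 ≤ t)
    (hOY : ∀ o ∈ O, ∀ y ∈ Y, (9 + cellOffset (o q) + cellOffset (y q) : ℝ) ^ 2 ≤ t) :
    O.card + X.card + Y.card ≤ 4 * g := by
  have h0 := card_le_four_mul_planeCells hpq O
  have h1 := card_le_four_mul_planeCells hpq X
  have h2 := card_le_four_mul_planeCells hpq Y
  have h3 := hb.card_add_card_add_card_le (F := planeCells p q X) (G := planeCells p q Y)
    (O := planeCells p q O) (hX.image _) (hY.image _) (by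
      simp only [planeCells, Finset.forall_mem_image]
      intro x hx y hy
      exact_mod_cast (h x hx y hy).trans_lt ht) (by
      simp only [planeCells, Finset.forall_mem_image]
      intro x hx y hy
      exact_mod_cast (hOX x hx y hy).trans_lt ht) (by
      simp only [planeCells, Finset.forall_mem_image]
      intro x hx y hy
      exact_mod_cast (hOY x hx y hy).trans_lt ht)
  omega

/-- The constraints on the cells met in a cube `O` and in its three neighbours `X`, `Y`, `Z`. -/
structure IsClaw (t : ℝ) (p q r : Fin 3) (O X Y Z : Finset (Fin 3 → Fin 4)) : Prop where
  pq : p ≠ q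
  pr : p ≠ r
  qr : q ≠ r
  neX : X.Nonempty
  neY : Y.Nonempty
  neZ : Z.Nonempty
  xy : ∀ x ∈ X, ∀ y ∈ Y, (diagSq (x p) (x q) (y p) (y q) : ℝ) ≤ t
  xz : ∀ x ∈ X, ∀ z ∈ Z, (diagSq (x p) (x r) (z p) (z r) : ℝ) ≤ t
  yz : ∀ y ∈ Y, ∀ z ∈ Z, (diagSq (y q) (y r) (z q) (z r) : ℝ) ≤ t
  ox : ∀ o ∈ O, ∀ x ∈ X, (9 + cellOffset (o p) + cellOffset (x p) : ℝ) ^ 2 ≤ t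
  oy : ∀ o ∈ O, ∀ y ∈ Y, (9 + cellOffset (o q) + cellOffset (y q) : ℝ) ^ 2 ≤ t
  oz : ∀ o ∈ O, ∀ z ∈ Z, (9 + cellOffset (o r) + cellOffset (z r) : ℝ) ^ 2 ≤ t

theorem diagSq_swap (a b c d : ℕ) : diagSq a b c d = diagSq b a d c := by
  simp only [diagSq]; ring

theorem diagSq_symm (a b c d : ℕ) : diagSq a b c d = diagSq c d a b := by
  simp only [diagSq]; ring

/-- Cyclic permutation of the three neighbours. -/
theorem IsClaw.rotate (h : IsClaw t p q r O X Y Z) : IsClaw t q r p O Y Z X where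
  pq := h.qr
  pr := h.pq.symm
  qr := h.pr.symm
  neX := h.neY
  neY := h.neZ
  neZ := h.neX
  xy := h.yz
  xz y hy x hx := by rw [diagSq_symm, diagSq_swap]; exact h.xy x hx y hy
  yz z hz x hx := by rw [diagSq_symm, diagSq_swap]; exact h.xz x hx z hz
  ox := h.oy
  oy := h.oz
  oz := h.ox

/-- Transposition of two of the neighbours. -/
theorem IsClaw.swap (h : IsClaw t p q r O X Y Z) : IsClaw t p r q O X Z Y where
  pq := h.pr
  pr := h.pq
  qr := h.qr.symm
  neX := h.neX
  neY := h.neZ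
  neZ := h.neY
  xy := h.xz
  xz := h.xy
  yz z hz y hy := by rw [diagSq_symm, diagSq_swap]; exact h.yz y hy z hz
  ox := h.ox
  oy := h.oz
  oz := h.oy

theorem IsClaw.diagSq_le (h : IsClaw t p q r O X Y Z) {x y : Fin 3 → Fin 4} (hx : x ∈ X)
    (hy : y ∈ Y) {a b c d : ℕ} (ha : a ≤ x p) (hb : b ≤ x q) (hc : c ≤ y p) (hd : d ≤ y q) :
    (diagSq a b c d : ℝ) ≤ t :=
  le_trans (by exact_mod_cast diagSq_mono ha hb hc hd) (h.xy x hx y hy)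

/-- Some cell of `S` lies in the outer half in direction `p`. -/
def IsFar (p : Fin 3) (S : Finset (Fin 3 → Fin 4)) : Prop := ∃ x ∈ S, 2 ≤ (x p).val

theorem le_one_of_not_isFar {S : Finset (Fin 3 → Fin 4)} (h : ¬IsFar p S) {x : Fin 3 → Fin 4}
    (hx : x ∈ S) : (x p).val ≤ 1 := by
  by_contra hlt
  exact h ⟨x, hx, by omega⟩

theorem card_le_of_not_isFar {S : Finset (Fin 3 → Fin 4)} (h : ¬IsFar p S) : S.card ≤ 32 := by
  have key : ∀ p : Fin 3, (Finset.univ.filter fun c : Fin 3 → Fin 4 => (c p).val ≤ 1).card ≤ 32 := by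
    decide +kernel
  exact (Finset.card_le_card fun x hx => Finset.mem_filter.2
    ⟨Finset.mem_univ _, le_one_of_not_isFar h hx⟩).trans (key p)

theorem card_le_of_not_isFar₂ {S : Finset (Fin 3 → Fin 4)} (hpr : p ≠ r) (hp : ¬IsFar p S)
    (hr : ¬IsFar r S) : S.card ≤ 16 := by
  have key : ∀ p r : Fin 3, p ≠ r → (Finset.univ.filter fun c : Fin 3 → Fin 4 =>
      (c p).val ≤ 1 ∧ (c r).val ≤ 1).card ≤ 16 := by
    decide +kernel
  exact (Finset.card_le_card fun x hx => Finset.mem_filter.2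
    ⟨Finset.mem_univ _, le_one_of_not_isFar hp hx, le_one_of_not_isFar hr hx⟩).trans (key p r hpr)

theorem card_le_of_not_isFar₃ {S : Finset (Fin 3 → Fin 4)} (hpq : p ≠ q) (hpr : p ≠ r)
    (hqr : q ≠ r) (hp : ¬IsFar p S) (hq : ¬IsFar q S) (hr : ¬IsFar r S) : S.card ≤ 8 := by
  have key : ∀ p q r : Fin 3, p ≠ q → p ≠ r → q ≠ r → (Finset.univ.filter fun c : Fin 3 → Fin 4 =>
      (c p).val ≤ 1 ∧ (c q).val ≤ 1 ∧ (c r).val ≤ 1).card ≤ 8 := by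
    decide +kernel
  exact (Finset.card_le_card fun x hx => Finset.mem_filter.2
    ⟨Finset.mem_univ _, le_one_of_not_isFar hp hx, le_one_of_not_isFar hq hx,
      le_one_of_not_isFar hr hx⟩).trans (key p q r hpq hpr hqr)

theorem card_cells_le (S : Finset (Fin 3 → Fin 4)) : S.card ≤ 64 :=
  (Finset.card_le_univ S).trans_eq (by simp)

/-- The cyclic configuration, in which each neighbour reaches out in one direction only. -/
structure IsCyclicClaw (t : ℝ) (p q r : Fin 3) (O X Y Z : Finset (Fin 3 → Fin 4)) : Prop extends
    IsClaw t p q r O X Y Z where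
  farX : IsFar q X
  farY : IsFar r Y
  farZ : IsFar p Z
  nearXp : ¬IsFar p X
  nearXr : ¬IsFar r X
  nearYq : ¬IsFar q Y
  nearYp : ¬IsFar p Y
  nearZr : ¬IsFar r Z
  nearZq : ¬IsFar q Z

theorem IsCyclicClaw.rotate (h : IsCyclicClaw t p q r O X Y Z) :
    IsCyclicClaw t q r p O Y Z X where
  toIsClaw := h.toIsClaw.rotate
  farX := h.farY
  farY := h.farZ
  farZ := h.farX
  nearXp := h.nearYq
  nearXr := h.nearYp
  nearYq := h.nearZr
  nearYp := h.nearZq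
  nearZr := h.nearXp
  nearZq := h.nearXr

theorem IsCyclicClaw.card_le_sixteen (h : IsCyclicClaw t p q r O X Y Z) : X.card ≤ 16 :=
  card_le_of_not_isFar₂ h.pr h.nearXp h.nearXr

/-- A cell of `X` with indices 1 and 3 in the directions `p` and `q` has squared distance at least
11² + 17² = 410 from `Y`. This removes two of the sixteen possible cells. -/
theorem IsCyclicClaw.card_le_fourteen (h : IsCyclicClaw t p q r O X Y Z) (ht : t < 410) :
    X.card ≤ 14 := by
  have key : ∀ p q r : Fin 3, p ≠ q → p ≠ r → q ≠ r → (Finset.univ.filter fun c : Fin 3 → Fin 4 =>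
      (c p).val ≤ 1 ∧ (c r).val ≤ 1 ∧ ¬(c p = 1 ∧ c q = 3)).card ≤ 14 := by
    decide +kernel
  refine (Finset.card_le_card fun x hx => Finset.mem_filter.2
    ⟨Finset.mem_univ _, le_one_of_not_isFar h.nearXp hx, le_one_of_not_isFar h.nearXr hx,
      ?_⟩).trans (key p q r h.pq h.pr h.qr)
  rintro ⟨h1, h3⟩
  obtain ⟨y, hy⟩ := h.neY
  have := h.diagSq_le hx hy (a := 1) (b := 3) (by simp [h1]) (by simp [h3]) (Nat.zero_le _)
    (Nat.zero_le _)
  norm_num [diagSq, cellOffset] at this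
  linarith

/-- Against a cell of `X` with offset at least 6 in direction `q`, a nonzero index of `Y` in
direction `p` costs 11² + 15² = 346, and one in direction `q` costs 9² + 17² = 370. Only one row of
four cells survives. -/
theorem IsCyclicClaw.card_le_four (h : IsCyclicClaw t p q r O X Y Z) (ht : t < 346) :
    Y.card ≤ 4 := by
  have key : ∀ p q : Fin 3, p ≠ q → (Finset.univ.filter fun c : Fin 3 → Fin 4 =>
      (c p).val = 0 ∧ (c q).val = 0).card ≤ 4 := by
    decide +kernel
  obtain ⟨x, hx, hxq⟩ := h.farX
  refine (Finset.card_le_card fun y hy => Finset.mem_filter.2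
    ⟨Finset.mem_univ _, ?_, ?_⟩).trans (key p q h.pq)
  · by_contra hne
    have := h.diagSq_le hx hy (c := 1) (Nat.zero_le _) hxq (by omega) (Nat.zero_le _)
    norm_num [diagSq, cellOffset] at this
    linarith
  · by_contra hne
    have := h.diagSq_le hx hy (d := 1) (Nat.zero_le _) hxq (Nat.zero_le _) (by omega)
    norm_num [diagSq, cellOffset] at this
    linarith

/-- Two outer cells facing each other in direction `p` are at distance at least 9 + 6 + 6 = 21, and
21² = 441. -/
theorem IsClaw.near_corner (h : IsClaw t p q r O X Y Z) (ht : t < 441) (hX : IsFar p X) :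
    O.card ≤ 32 := by
  obtain ⟨x, hx, hxp⟩ := hX
  refine card_le_of_not_isFar (p := p) ?_
  rintro ⟨o, ho, hop⟩
  have h1 := h.ox o ho x hx
  have h2 : (9 + cellOffset 2 + cellOffset 2 : ℝ) ≤ 9 + cellOffset (o p) + cellOffset (x p) := by
    exact_mod_cast add_le_add (add_le_add le_rfl (cellOffset_mono hop)) (cellOffset_mono hxp)
  norm_num [cellOffset] at h1 h2
  nlinarith

/-- If both reached out crosswise, the squared distance would be at least 15² + 15² = 450. -/
theorem IsClaw.not_isFar (h : IsClaw t p q r O X Y Z) (ht : t < 441) (hX : IsFar q X) :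
    ¬IsFar p Y := by
  rintro ⟨y, hy, hyp⟩
  obtain ⟨x, hx, hxq⟩ := hX
  have := h.diagSq_le hx hy (Nat.zero_le _) hxq hyp (Nat.zero_le _)
  norm_num [diagSq, cellOffset] at this
  linarith

/-- A neighbour with more than 8 cells is far in some direction, here not its own. By `not_isFar`,
no two neighbours are each far in the other's direction, so the choice made by `X` propagates around
one of the two orientations of the 3-cycle. -/
theorem IsClaw.cyclic (h : IsClaw t p q r O X Y Z) (ht : t < 441) (hX : ¬IsFar p X)
    (hY : ¬IsFar q Y) (hZ : ¬IsFar r Z) (hX8 : ¬X.card ≤ 8) (hY8 : ¬Y.card ≤ 8)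
    (hZ8 : ¬Z.card ≤ 8) : IsCyclicClaw t p q r O X Y Z ∨ IsCyclicClaw t p r q O X Z Y := by
  have hXqr : IsFar q X ∨ IsFar r X := by
    by_contra! hc
    exact hX8 (card_le_of_not_isFar₃ h.pq h.pr h.qr hX hc.1 hc.2)
  have hYrp : IsFar r Y ∨ IsFar p Y := by
    by_contra! hc
    exact hY8 (card_le_of_not_isFar₃ h.qr h.pq.symm h.pr.symm hY hc.1 hc.2)
  have hZpq : IsFar p Z ∨ IsFar q Z := by
    by_contra! hc
    exact hZ8 (card_le_of_not_isFar₃ h.pr.symm h.qr.symm h.pq hZ hc.1 hc.2)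
  have xy := h.not_isFar ht
  have yz := h.rotate.not_isFar ht
  have zx := h.rotate.rotate.not_isFar ht
  by_cases hc : IsFar q X
  · have a := hYrp.resolve_right (xy hc)
    have b := hZpq.resolve_right (yz a)
    exact Or.inl ⟨h, hc, a, b, hX, zx b, hY, xy hc, hZ, yz a⟩
  · have a := hXqr.resolve_left hc
    have b : ¬IsFar p Z := fun H => zx H a
    have c := hZpq.resolve_left b
    have d : ¬IsFar r Y := fun H => yz H c
    exact Or.inr ⟨h.swap, a, c, hYrp.resolve_left d, hX, hc, hZ, b, hY, d⟩

theorem IsClaw.two_mul_card_le {g : ℕ} (h : IsClaw t p q r O X Y Z) (hb : PairBound T g)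
    (ht : t < T) : 2 * (X.card + Y.card + Z.card) ≤ 12 * g := by
  have h1 := hb.card_cells_le ht h.pq h.neX h.neY h.xy
  have h2 := hb.card_cells_le ht h.pr h.neX h.neZ h.xz
  have h3 := hb.card_cells_le ht h.qr h.neY h.neZ h.yz
  omega

theorem IsClaw.card_triple_le {g : ℕ} (h : IsClaw t p q r O X Y Z) (hb : TripleBound T g)
    (ht : t < T) : O.card + X.card + Y.card ≤ 4 * g :=
  hb.card_cells_le ht h.pq h.neX h.neY h.xy h.ox h.oy

/-- The three pair bounds give `X + Y + Z ≤ 6g` for the cardinalities; add 64 for `O`. Averaging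
these with the three triple bounds gives the other estimate. -/
theorem IsClaw.card_le {g m : ℕ} (h : IsClaw t p q r O X Y Z) (hg : PairBound T g)
    (hm : TripleBound T m) (ht : t < T) :
    O.card + X.card + Y.card + Z.card ≤ min (64 + 6 * g) (4 * m + 2 * g) := by
  have h1 := h.two_mul_card_le hg ht
  have h2 := h.card_triple_le hm ht
  have h3 := h.rotate.card_triple_le hm ht
  have h4 := h.rotate.rotate.card_triple_le hm ht
  have h5 := card_cells_le O
  omega

/-- The refined estimate for small diameters; `k` bounds the pieces of a cyclic
configuration. -/
theorem IsClaw.card_le_of_lt {g m k : ℕ} (h : IsClaw t p q r O X Y Z) (hg : PairBound T g)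
    (hm : TripleBound T m) (ht : t < T) (hT : T ≤ 441)
    (hk : ∀ p q r X Y Z, IsCyclicClaw t p q r O X Y Z → X.card ≤ k) :
    O.card + X.card + Y.card + Z.card ≤ max (32 + 6 * g) (max (4 * m + 8) (64 + 3 * k)) := by
  have ht' : t < 441 := ht.trans_le (by exact_mod_cast hT)
  have h1 := h.two_mul_card_le hg ht
  have h2 := h.card_triple_le hm ht
  have h3 := h.rotate.card_triple_le hm ht
  have h4 := h.rotate.rotate.card_triple_le hm ht
  have h5 := card_cells_le O
  -- A neighbour far in its own direction halves `O`; a neighbour with at most 8 cells is added to a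
  -- triple bound; the remaining case is cyclic.
  by_cases hX : IsFar p X
  · have := h.near_corner ht' hX
    omega
  by_cases hY : IsFar q Y
  · have := h.rotate.near_corner ht' hY
    omega
  by_cases hZ : IsFar r Z
  · have := h.rotate.rotate.near_corner ht' hZ
    omega
  by_cases hX8 : X.card ≤ 8
  · omega
  by_cases hY8 : Y.card ≤ 8
  · omega
  by_cases hZ8 : Z.card ≤ 8
  · omega
  rcases h.cyclic ht' hX hY hZ hX8 hY8 hZ8 with hc | hc
  all_goals
    have c1 := hk _ _ _ _ _ _ hc
    have c2 := hk _ _ _ _ _ _ hc.rotate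
    have c3 := hk _ _ _ _ _ _ hc.rotate.rotate
    omega

theorem IsClaw.false_of_massBound (h : IsClaw t p q r O X Y Z)
    (hm : MassBound t (O.card + X.card + Y.card + Z.card)) : False := by
  have h0 : O.card + X.card + Y.card + Z.card ≤ 256 := by
    have h1 := card_cells_le O
    have h2 := card_cells_le X
    have h3 := card_cells_le Y
    have h4 := card_cells_le Z
    omega
  have low : 162 ≤ t := by
    obtain ⟨x, hx⟩ := h.neX
    obtain ⟨y, hy⟩ := h.neY
    have := h.diagSq_le hx hy (Nat.zero_le _) (Nat.zero_le _) (Nat.zero_le _) (Nat.zero_le _)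
    norm_num [diagSq, cellOffset] at this
    exact this
  -- The counts descend through 220, 196, 178, 160, 152, 138, 132, 126. The general estimate is then
  -- replaced, at `T` = 418, 369 and 307, by the refined one for `T ≤ 441`.
  have h1 := h.card_le pairBound_883 tripleBound_883 (hm 256 883 h0 (by norm_num) (by norm_num))
  have h2 := h.card_le pairBound_752 tripleBound_752 (hm _ 752 h1 (by norm_num) (by norm_num))
  have h3 := h.card_le pairBound_666 tripleBound_666 (hm _ 666 h2 (by norm_num) (by norm_num))
  have h4 := h.card_le pairBound_602 tripleBound_602 (hm _ 602 h3 (by norm_num) (by norm_num))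
  have h5 := h.card_le pairBound_538 tripleBound_538 (hm _ 538 h4 (by norm_num) (by norm_num))
  have h6 := h.card_le pairBound_509 tripleBound_509 (hm _ 509 h5 (by norm_num) (by norm_num))
  have h7 := h.card_le pairBound_460 tripleBound_460 (hm _ 460 h6 (by norm_num) (by norm_num))
  have h8 := h.card_le pairBound_439 tripleBound_439 (hm _ 439 h7 (by norm_num) (by norm_num))
  have t418 : t < (418 : ℕ) := hm _ 418 h8 (by norm_num) (by norm_num)
  have h9 := h.card_le_of_lt (k := 16) pairBound_418 tripleBound_418 t418 (by norm_num)
    fun _ _ _ _ _ _ hc => hc.card_le_sixteen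
  have t369 : t < (369 : ℕ) := hm _ 369 h9 (by norm_num) (by norm_num)
  have h10 := h.card_le_of_lt (k := 14) pairBound_369 tripleBound_369 t369 (by norm_num)
    fun _ _ _ _ _ _ hc => hc.card_le_fourteen (by norm_num at t369; linarith)
  have h11 := h.card_le pairBound_348 tripleBound_348 (hm _ 348 h10 (by norm_num) (by norm_num))
  have h12 := h.card_le pairBound_334 tripleBound_334 (hm _ 334 h11 (by norm_num) (by norm_num))
  have t307 : t < (307 : ℕ) := hm _ 307 h12 (by norm_num) (by norm_num)
  have h13 := h.card_le_of_lt (k := 4) pairBound_307 tripleBound_307 t307 (by norm_num)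
    fun _ _ _ _ _ _ hc => hc.rotate.rotate.card_le_four (by norm_num at t307; linarith)
  have h14 := h.card_le pairBound_286 tripleBound_286 (hm _ 286 h13 (by norm_num) (by norm_num))
  have h15 := h.card_le pairBound_204 tripleBound_204 (hm _ 204 h14 (by norm_num) (by norm_num))
  -- The last count, 40, already forces `t` below the diagonal gap 9² + 9² = 162.
  have h16 := hm _ 162 h15 (by norm_num) (by norm_num)
  norm_num at h16
  linarith

end Cells

/-! ### Two cubes sharing a face -/

/-- The distance of two triadic intervals in the same third of the Cantor set, in units of
`1 / 27`. -/
def innerGap (a b : ℕ) : ℕ :=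
  max (cellOffset a - cellOffset b - 1) (cellOffset b - cellOffset a - 1)

/-- The number of positions whose reflection is at squared distance less than `K`. -/
def reflectionDefect (K : ℕ) : ℕ :=
  (Finset.univ.filter fun x : Fin 4 × Fin 4 =>
    innerGap x.1 x.1.rev ^ 2 + innerGap x.2 x.2.rev ^ 2 < K).card

/-- A coordinate and its reflection are at gap 7 (outermost pair) or 3 (middle pair), so the sums of
squares are 18, 58 and 98. Below 58 only the four middle positions remain; below 98 all but the four
corners. -/
theorem reflectionDefect_58 : reflectionDefect 58 = 4 := by decide +kernel
theorem reflectionDefect_98 : reflectionDefect 98 = 12 := by decide +kernel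

/-- Reflect `G`: the union with `F` has at most 16 cells, and each cell of the intersection pairs a
cell of `F` with its mirror image in `G`, so it counts towards the defect. -/
theorem card_add_card_le_reflectionDefect {F G : Finset (Fin 4 × Fin 4)} {K : ℕ}
    (h : ∀ x ∈ F, ∀ y ∈ G, innerGap x.1 y.1 ^ 2 + innerGap x.2 y.2 ^ 2 < K) :
    F.card + G.card ≤ 16 + reflectionDefect K := by
  have inj : Function.Injective fun x : Fin 4 × Fin 4 => (x.1.rev, x.2.rev) := by
    intro x y hxy
    simpa [Prod.ext_iff] using hxy
  rw [← Finset.card_image_of_injective G inj, ← Finset.card_union_add_card_inter]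
  refine add_le_add ((Finset.card_le_univ _).trans_eq (by simp)) (Finset.card_le_card fun x hx => ?_)
  rw [Finset.mem_inter, Finset.mem_image] at hx
  obtain ⟨hx, y, hy, rfl⟩ := hx
  refine Finset.mem_filter.2 ⟨Finset.mem_univ _, ?_⟩
  have := h _ hx y hy
  simpa using this

section Adjacent

variable {t : ℝ} {p q r : Fin 3} {X Y : Finset (Fin 3 → Fin 4)}

/-- The cells of `S` in the slab of index `j` in direction `p`. -/
def slab (p : Fin 3) (S : Finset (Fin 3 → Fin 4)) (j : Fin 4) : Finset (Fin 3 → Fin 4) :=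
  S.filter fun c => c p = j

theorem card_eq_sum_slab (p : Fin 3) (S : Finset (Fin 3 → Fin 4)) :
    S.card = (slab p S 0).card + (slab p S 1).card + (slab p S 2).card + (slab p S 3).card := by
  rw [Finset.card_eq_sum_card_fiberwise (f := fun c => c p) (t := Finset.univ) (by simp),
    Fin.sum_univ_four]
  rfl

theorem card_slab_eq (hall : ∀ k, k = p ∨ k = q ∨ k = r) (S : Finset (Fin 3 → Fin 4)) (j : Fin 4) :
    (slab p S j).card = (planeCells q r (slab p S j)).card := by
  refine (Finset.card_image_of_injOn ?_).symm
  intro c hc d hd h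
  have hc' := (Finset.mem_filter.1 (Finset.mem_coe.1 hc)).2
  have hd' := (Finset.mem_filter.1 (Finset.mem_coe.1 hd)).2
  funext k
  rcases hall k with rfl | rfl | rfl
  exacts [hc'.trans hd'.symm, congrArg Prod.fst h, congrArg Prod.snd h]

/-- Numerical contradiction for two adjacent cubes, from the cardinalities of the slabs. -/
theorem MassBound.false_of_slabs {a b : Fin 4 → ℕ}
    (ha : ∀ j, a j ≤ 16) (hb : ∀ j, b j ≤ 16)
    (ha0 : 0 < a 0 + a 1 + a 2 + a 3) (hb0 : 0 < b 0 + b 1 + b 2 + b 3) (low : 81 ≤ t)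
    (hpair : ∀ (i j : Fin 4) (K : ℕ), t < (((9 + cellOffset i + cellOffset j) ^ 2 + K : ℕ) : ℝ) →
      a i + b j ≤ 16 + reflectionDefect K)
    (hconf : ∀ i j : Fin 4, t < (((9 + cellOffset i + cellOffset j) ^ 2 : ℕ) : ℝ) →
      a i = 0 ∨ b j = 0)
    (hfar : b 2 = 0 ∧ b 3 = 0)
    (hm : MassBound t (a 0 + a 1 + a 2 + a 3 + (b 0 + b 1 + b 2 + b 3))) : False := by
  have a0 := ha 0
  have a1 := ha 1
  have a2 := ha 2
  have a3 := ha 3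
  have b0 := hb 0
  have b1 := hb 1
  -- Four slabs on one side and two on the other hold at most 6 · 16 = 96 cells. The thresholds that
  -- follow are the squares 17², 13², 11² of slab distances.
  have t314 := hm 96 314 (by omega) (by norm_num) (by norm_num)
  norm_num at t314
  have c31 := hconf 3 1 (by norm_num [cellOffset]; linarith)
  rcases lt_or_ge t 289 with h | h
  · have c30 := hconf 3 0 (by norm_num [cellOffset]; linarith)
    have c21 := hconf 2 1 (by norm_num [cellOffset]; linarith)
    have t204 := hm 64 204 (by omega) (by norm_num) (by norm_num)
    norm_num at t204
    have c20 := hconf 2 0 (by norm_num [cellOffset]; linarith)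
    rcases lt_or_ge t 169 with h169 | h169
    · have c11 := hconf 1 1 (by norm_num [cellOffset]; linarith)
      rcases lt_or_ge t 121 with h121 | h121
      · have c10 := hconf 1 0 (by norm_num [cellOffset]; linarith)
        have c01 := hconf 0 1 (by norm_num [cellOffset]; linarith)
        have p00 := hpair 0 0 58 (by norm_num [cellOffset]; linarith)
        rw [reflectionDefect_58] at p00
        have := hm 20 81 (by omega) (by norm_num) (by norm_num)
        norm_num at this
        linarith
      · have p10 := hpair 1 0 58 (by norm_num [cellOffset]; linarith)
        have p01 := hpair 0 1 58 (by norm_num [cellOffset]; linarith)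
        rw [reflectionDefect_58] at p10 p01
        have := hm 36 121 (by omega) (by norm_num) (by norm_num)
        norm_num at this
        linarith
    · have p11 := hpair 1 1 58 (by norm_num [cellOffset]; linarith)
      rw [reflectionDefect_58] at p11
      have := hm 52 169 (by omega) (by norm_num) (by norm_num)
      norm_num at this
      linarith
  -- Here 15² + 98 = 323 exceeds `t`, so slabs 2 and 0 together hold at most 28 cells; the total is
  -- at most 28 + 3 · 16 = 76.
  · have p20 := hpair 2 0 98 (by norm_num [cellOffset]; linarith)
    rw [reflectionDefect_98] at p20
    have := hm 76 289 (by omega) (by norm_num) (by norm_num)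
    norm_num at this
    linarith

theorem MassBound.false_of_adjacent (hpq : p ≠ q) (hpr : p ≠ r) (hqr : q ≠ r) (hX : X.Nonempty)
    (hY : Y.Nonempty)
    (h : ∀ x ∈ X, ∀ y ∈ Y, (((9 + cellOffset (x p) + cellOffset (y p)) ^ 2 +
      (innerGap (x q) (y q) ^ 2 + innerGap (x r) (y r) ^ 2) : ℕ) : ℝ) ≤ t)
    (hm : MassBound t (X.card + Y.card)) : False := by
  have hall : ∀ k, k = p ∨ k = q ∨ k = r := by
    clear * - hpq hpr hqr
    revert p q r
    decide
  have h16 : ∀ S j, (slab p S j).card ≤ 16 := fun S j => by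
    rw [card_slab_eq hall]
    exact (Finset.card_le_univ _).trans_eq (by simp)
  have X0 := card_eq_sum_slab p X
  have Y0 := card_eq_sum_slab p Y
  have hX0 := hX.card_pos
  have hY0 := hY.card_pos
  have low : 81 ≤ t := by
    obtain ⟨x, hx⟩ := hX
    obtain ⟨y, hy⟩ := hY
    refine le_trans ?_ (h x hx y hy)
    have : 9 ^ 2 ≤ (9 + cellOffset (x p) + cellOffset (y p)) ^ 2 := by
      gcongr
      omega
    exact_mod_cast le_add_right this
  have hpair : ∀ (i j : Fin 4) (K : ℕ),
      t < (((9 + cellOffset i + cellOffset j) ^ 2 + K : ℕ) : ℝ) →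
        (slab p X i).card + (slab p Y j).card ≤ 16 + reflectionDefect K := by
    intro i j K hK
    rw [card_slab_eq hall, card_slab_eq hall]
    refine card_add_card_le_reflectionDefect ?_
    simp only [planeCells, Finset.forall_mem_image]
    intro x hx y hy
    obtain ⟨hxX, rfl⟩ := Finset.mem_filter.1 hx
    obtain ⟨hyY, rfl⟩ := Finset.mem_filter.1 hy
    have := Nat.cast_lt.1 ((h x hxX y hyY).trans_lt hK)
    omega
  have hconf : ∀ i j : Fin 4, t < (((9 + cellOffset i + cellOffset j) ^ 2 : ℕ) : ℝ) →
      (slab p X i).card = 0 ∨ (slab p Y j).card = 0 := by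
    intro i j ht
    by_contra! hne
    obtain ⟨x, hx⟩ := Finset.card_ne_zero.1 hne.1
    obtain ⟨y, hy⟩ := Finset.card_ne_zero.1 hne.2
    obtain ⟨hxX, rfl⟩ := Finset.mem_filter.1 hx
    obtain ⟨hyY, rfl⟩ := Finset.mem_filter.1 hy
    have := Nat.cast_lt.1 ((h x hxX y hyY).trans_lt ht)
    omega
  -- Outer slabs of the two cubes are at squared distance at least 21² = 441, so at most one of the
  -- cubes uses its outer slabs.
  have t425 := hm 128 425 (by
    have := card_cells_le X
    have := card_cells_le Y
    omega) (by norm_num) (by norm_num)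
  norm_num at t425
  have c22 := hconf 2 2 (by norm_num [cellOffset]; linarith)
  have c23 := hconf 2 3 (by norm_num [cellOffset]; linarith)
  have c32 := hconf 3 2 (by norm_num [cellOffset]; linarith)
  have c33 := hconf 3 3 (by norm_num [cellOffset]; linarith)
  by_cases hfar : (slab p Y 2).card = 0 ∧ (slab p Y 3).card = 0
  · refine MassBound.false_of_slabs (h16 X) (h16 Y) (by omega) (by omega) low hpair hconf hfar ?_
    rwa [← X0, ← Y0]
  · refine MassBound.false_of_slabs (h16 Y) (h16 X) (by omega) (by omega) low
      (fun i j K hK => ?_) (fun i j hK => ?_) (by omega) (by rwa [← X0, ← Y0, add_comm])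
    · rw [add_comm]
      exact hpair j i K (by rwa [add_right_comm])
    · exact (hconf j i (by rwa [add_right_comm])).symm

end Adjacent

/-! ### Vertex configurations and exclusion of two, three or four cubes -/

/-- `a` and `b` differ in at least two coordinates. -/
def IsDiagonal (a b : Fin 3 → Fin 2) : Prop :=
  ∃ p q, p ≠ q ∧ a p ≠ b p ∧ a q ≠ b q

/-- `o` separates `x` and `y`, as the corner of an `L` separates its two ends. -/
def IsTriple (o x y : Fin 3 → Fin 2) : Prop :=
  ∃ p q, p ≠ q ∧ o p ≠ x p ∧ o q ≠ y q ∧ x p ≠ y p ∧ x q ≠ y q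

/-- `x`, `y`, `z` are in the position of the three neighbours of `o`. -/
def IsClawVertices (o x y z : Fin 3 → Fin 2) : Prop :=
  ∃ p q r, (p ≠ q ∧ p ≠ r ∧ q ≠ r) ∧ (o p ≠ x p ∧ o q ≠ y q ∧ o r ≠ z r) ∧
    (x p ≠ y p ∧ x q ≠ y q) ∧ (x p ≠ z p ∧ x r ≠ z r) ∧ y q ≠ z q ∧ y r ≠ z r

instance (a b : Fin 3 → Fin 2) : Decidable (IsDiagonal a b) := by
  unfold IsDiagonal; infer_instance

instance (a b c : Fin 3 → Fin 2) : Decidable (IsTriple a b c) := by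
  unfold IsTriple; infer_instance

instance (a b c d : Fin 3 → Fin 2) : Decidable (IsClawVertices a b c d) := by
  unfold IsClawVertices; infer_instance

/-- Four vertices split into two diagonal pairs. -/
def IsSplit (a b c d : Fin 3 → Fin 2) : Prop :=
  (IsDiagonal a b ∧ IsDiagonal c d) ∨ (IsDiagonal a c ∧ IsDiagonal b d) ∨
    (IsDiagonal a d ∧ IsDiagonal b c)

/-- Four vertices form a claw in some order. -/
def FormClaw (a b c d : Fin 3 → Fin 2) : Prop :=
  IsClawVertices a b c d ∨ IsClawVertices b a c d ∨ IsClawVertices c a b d ∨ IsClawVertices d a b c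

instance (a b c d : Fin 3 → Fin 2) : Decidable (IsSplit a b c d) := by
  unfold IsSplit; infer_instance

instance (a b c d : Fin 3 → Fin 2) : Decidable (FormClaw a b c d) := by
  unfold FormClaw; infer_instance

theorem isDiagonal_or_adjacent : ∀ a b : Fin 3 → Fin 2, a ≠ b → IsDiagonal a b ∨
    ∃ p q r, p ≠ q ∧ p ≠ r ∧ q ≠ r ∧ a p ≠ b p ∧ a q = b q ∧ a r = b r := by
  decide +kernel

theorem isTriple_of_ne : ∀ a b c : Fin 3 → Fin 2, a ≠ b → a ≠ c → b ≠ c →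
    IsTriple a b c ∨ IsTriple b a c ∨ IsTriple c a b := by
  decide +kernel

theorem isSplit_or_formClaw : ∀ a b c d : Fin 3 → Fin 2, a ≠ b → a ≠ c → a ≠ d → b ≠ c → b ≠ d →
    c ≠ d → IsSplit a b c d ∨ FormClaw a b c d := by
  decide +kernel

/-- A lower bound, in units of `1 / 27`, for the distance of points in the cells of offsets `c`
and `c'` of the thirds `v` and `v'` of the Cantor set. -/
def cellGap (v v' : Fin 2) (c c' : Fin 4) : ℕ :=
  if v = v' then innerGap c c' else 9 + cellOffset c + cellOffset c'

section Core

variable {t : ℝ} {occ : (Fin 3 → Fin 2) → Finset (Fin 3 → Fin 4)}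

/-- The cells in `occ` are pairwise at squared distance at most `t`, in units of `1 / 27`. -/
def CellsWithin (t : ℝ) (occ : (Fin 3 → Fin 2) → Finset (Fin 3 → Fin 4)) : Prop :=
  ∀ v v', ∀ c ∈ occ v, ∀ c' ∈ occ v', ((∑ k, cellGap (v k) (v' k) (c k) (c' k) ^ 2 : ℕ) : ℝ) ≤ t

theorem CellsWithin.diagSq_le (h : CellsWithin t occ) {v v' : Fin 3 → Fin 2} {p q : Fin 3}
    (hpq : p ≠ q) (hp : v p ≠ v' p) (hq : v q ≠ v' q) {x y : Fin 3 → Fin 4} (hx : x ∈ occ v)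
    (hy : y ∈ occ v') : (diagSq (x p) (x q) (y p) (y q) : ℝ) ≤ t := by
  refine le_trans ?_ (h v v' x hx y hy)
  have := Finset.sum_le_univ_sum_of_nonneg (s := {p, q})
    (f := fun k => cellGap (v k) (v' k) (x k) (y k) ^ 2) (fun _ => Nat.zero_le _)
  rw [Finset.sum_pair hpq, cellGap, if_neg hp, cellGap, if_neg hq] at this
  exact_mod_cast this

theorem CellsWithin.sq_le (h : CellsWithin t occ) {v v' : Fin 3 → Fin 2} {p : Fin 3}
    (hp : v p ≠ v' p) {x y : Fin 3 → Fin 4} (hx : x ∈ occ v) (hy : y ∈ occ v') :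
    (9 + cellOffset (x p) + cellOffset (y p) : ℝ) ^ 2 ≤ t := by
  refine le_trans ?_ (h v v' x hx y hy)
  have := Finset.single_le_sum (f := fun k => cellGap (v k) (v' k) (x k) (y k) ^ 2)
    (fun _ _ => Nat.zero_le _) (Finset.mem_univ p)
  simp only [cellGap, if_neg hp] at this
  exact_mod_cast this

theorem CellsWithin.low (h : CellsWithin t occ) {a b : Fin 3 → Fin 2} (hab : IsDiagonal a b)
    (ha : (occ a).Nonempty) (hb : (occ b).Nonempty) : 162 ≤ t := by
  obtain ⟨p, q, hpq, hp, hq⟩ := hab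
  obtain ⟨x, hx⟩ := ha
  obtain ⟨y, hy⟩ := hb
  refine le_trans ?_ (h.diagSq_le hpq hp hq hx hy)
  have := diagSq_mono (Nat.zero_le (x p)) (Nat.zero_le (x q)) (Nat.zero_le (y p))
    (Nat.zero_le (y q))
  have h0 : diagSq 0 0 0 0 = 162 := rfl
  rw [h0] at this
  exact_mod_cast this

theorem CellsWithin.pair_card_le (h : CellsWithin t occ) {a b : Fin 3 → Fin 2}
    (hab : IsDiagonal a b) (ha : (occ a).Nonempty) (hb : (occ b).Nonempty) {T g : ℕ}
    (hg : PairBound T g) (ht : t < T) : (occ a).card + (occ b).card ≤ 4 * g := by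
  obtain ⟨p, q, hpq, hp, hq⟩ := hab
  exact hg.card_cells_le ht hpq ha hb fun x hx y hy => h.diagSq_le hpq hp hq hx hy

theorem CellsWithin.false_of_diagonal (h : CellsWithin t occ) {a b : Fin 3 → Fin 2}
    (hab : IsDiagonal a b) (ha : (occ a).Nonempty) (hb : (occ b).Nonempty)
    (hm : MassBound t ((occ a).card + (occ b).card)) : False := by
  have h1 := card_cells_le (occ a)
  have h2 := card_cells_le (occ b)
  refine hm.false_of_diagonal (by omega) (h.low hab ha hb) fun T g hg ht => ?_
  have := h.pair_card_le hab ha hb hg ht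
  omega

theorem CellsWithin.false_of_split (h : CellsWithin t occ) {a b c d : Fin 3 → Fin 2}
    (hab : IsDiagonal a b) (hcd : IsDiagonal c d) (ha : (occ a).Nonempty) (hb : (occ b).Nonempty)
    (hc : (occ c).Nonempty) (hd : (occ d).Nonempty)
    (hm : MassBound t ((occ a).card + (occ b).card + (occ c).card + (occ d).card)) : False := by
  have h1 := card_cells_le (occ a)
  have h2 := card_cells_le (occ b)
  have h3 := card_cells_le (occ c)
  have h4 := card_cells_le (occ d)
  refine hm.false_of_diagonal (by omega) (h.low hab ha hb) fun T g hg ht => ?_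
  have := h.pair_card_le hab ha hb hg ht
  have := h.pair_card_le hcd hc hd hg ht
  omega

theorem CellsWithin.false_of_triple (h : CellsWithin t occ) {o a b : Fin 3 → Fin 2}
    (hoab : IsTriple o a b) (ha : (occ a).Nonempty) (hb : (occ b).Nonempty)
    (hm : MassBound t ((occ o).card + (occ a).card + (occ b).card)) : False := by
  obtain ⟨p, q, hpq, hoa, hob, hp, hq⟩ := hoab
  have h1 := card_cells_le (occ a)
  have h2 := card_cells_le (occ b)
  have h3 := card_cells_le (occ o)
  exact hm.false_of_triple (by omega) (h.low ⟨p, q, hpq, hp, hq⟩ ha hb) fun T g hg ht =>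
    hg.card_cells_le ht hpq ha hb (fun x hx y hy => h.diagSq_le hpq hp hq hx hy)
      (fun x hx y hy => h.sq_le hoa hx hy) (fun x hx y hy => h.sq_le hob hx hy)

theorem CellsWithin.false_of_claw (h : CellsWithin t occ) {o a b c : Fin 3 → Fin 2}
    (hoabc : IsClawVertices o a b c) (ha : (occ a).Nonempty) (hb : (occ b).Nonempty)
    (hc : (occ c).Nonempty)
    (hm : MassBound t ((occ o).card + (occ a).card + (occ b).card + (occ c).card)) : False := by
  obtain ⟨p, q, r, ⟨hpq, hpr, hqr⟩, ⟨hoa, hob, hoc⟩, ⟨h1, h2⟩, ⟨h3, h4⟩, h5, h6⟩ := hoabc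
  refine IsClaw.false_of_massBound (p := p) (q := q) (r := r) ⟨hpq, hpr, hqr, ha, hb, hc,
    fun x hx y hy => h.diagSq_le hpq h1 h2 hx hy, fun x hx y hy => h.diagSq_le hpr h3 h4 hx hy,
    fun x hx y hy => h.diagSq_le hqr h5 h6 hx hy, fun x hx y hy => h.sq_le hoa hx hy,
    fun x hx y hy => h.sq_le hob hx hy, fun x hx y hy => h.sq_le hoc hx hy⟩ hm

theorem CellsWithin.false_of_two (h : CellsWithin t occ) {a b : Fin 3 → Fin 2} (hab : a ≠ b)
    (ha : (occ a).Nonempty) (hb : (occ b).Nonempty)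
    (hm : MassBound t ((occ a).card + (occ b).card)) : False := by
  rcases isDiagonal_or_adjacent a b hab with hd | ⟨p, q, r, hpq, hpr, hqr, hp, hq, hr⟩
  · exact h.false_of_diagonal hd ha hb hm
  · refine hm.false_of_adjacent hpq hpr hqr ha hb fun x hx y hy => ?_
    refine le_trans ?_ (h a b x hx y hy)
    have := Finset.sum_le_univ_sum_of_nonneg (s := {p, q, r})
      (f := fun k => cellGap (a k) (b k) (x k) (y k) ^ 2) (fun _ => Nat.zero_le _)
    rw [Finset.sum_insert (by simp [hpq, hpr]), Finset.sum_pair hqr, cellGap, if_neg hp, cellGap,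
      if_pos hq, cellGap, if_pos hr] at this
    exact_mod_cast this

/-- A set meeting two, three or four cubes is too large for its mass. -/
theorem CellsWithin.false_of_card (h : CellsWithin t occ)
    (h2 : 2 ≤ (Finset.univ.filter fun v => (occ v).Nonempty).card)
    (h4 : (Finset.univ.filter fun v => (occ v).Nonempty).card ≤ 4)
    (hm : MassBound t (∑ v, (occ v).card)) : False := by
  have hsum : ∑ v, (occ v).card =
      ∑ v ∈ Finset.univ.filter fun v => (occ v).Nonempty, (occ v).card := by
    rw [Finset.sum_filter_of_ne]
    intro v _ hv
    exact Finset.card_ne_zero.1 hv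
  have hne : ∀ v ∈ Finset.univ.filter fun v => (occ v).Nonempty, (occ v).Nonempty :=
    fun v hv => (Finset.mem_filter.1 hv).2
  rw [hsum] at hm
  generalize (Finset.univ.filter fun v => (occ v).Nonempty) = V at *
  obtain hV | hV | hV : V.card = 2 ∨ V.card = 3 ∨ V.card = 4 := by omega
  · obtain ⟨a, b, hab, rfl⟩ := Finset.card_eq_two.1 hV
    rw [Finset.sum_pair hab] at hm
    exact h.false_of_two hab (hne a (by simp)) (hne b (by simp)) hm
  · obtain ⟨a, b, c, hab, hac, hbc, rfl⟩ := Finset.card_eq_three.1 hV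
    rw [Finset.sum_insert (by simp [hab, hac]), Finset.sum_pair hbc] at hm
    have ha := hne a (by simp)
    have hb := hne b (by simp)
    have hc := hne c (by simp)
    rcases isTriple_of_ne a b c hab hac hbc with H | H | H
    · exact h.false_of_triple H hb hc (by convert hm using 1; omega)
    · exact h.false_of_triple H ha hc (by convert hm using 1; omega)
    · exact h.false_of_triple H ha hb (by convert hm using 1; omega)
  · obtain ⟨d, W, hdW, rfl, hW⟩ := Finset.card_eq_succ.1 hV
    obtain ⟨a, b, c, hab, hac, hbc, rfl⟩ := Finset.card_eq_three.1 hW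
    rw [Finset.sum_insert hdW, Finset.sum_insert (by simp [hab, hac]), Finset.sum_pair hbc] at hm
    simp only [Finset.mem_insert, Finset.mem_singleton, not_or] at hdW
    have ha := hne a (by simp)
    have hb := hne b (by simp)
    have hc := hne c (by simp)
    have hd := hne d (by simp)
    rcases isSplit_or_formClaw a b c d hab hac (Ne.symm hdW.1) hbc (Ne.symm hdW.2.1)
      (Ne.symm hdW.2.2) with (⟨H, H'⟩ | ⟨H, H'⟩ | ⟨H, H'⟩) | H | H | H | H
    · exact h.false_of_split H H' ha hb hc hd (by convert hm using 1; omega)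
    · exact h.false_of_split H H' ha hc hb hd (by convert hm using 1; omega)
    · exact h.false_of_split H H' ha hd hb hc (by convert hm using 1; omega)
    · exact h.false_of_claw H hb hc hd (by convert hm using 1; omega)
    · exact h.false_of_claw H ha hc hd (by convert hm using 1; omega)
    · exact h.false_of_claw H ha hb hd (by convert hm using 1; omega)
    · exact h.false_of_claw H ha hb hc (by convert hm using 1; omega)

end Core

/-! ### The exponent and the numerical mass bound -/

/-- This is `8^28 ≤ 3^53`; the fraction 53/28 yields the integer exponents 53 and 56 = 2 · 28 of
`MassBound`. -/
theorem logb_three_eight_le : 28 * Real.logb 3 8 ≤ 53 := by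
  have h : (28 : ℝ) * Real.logb 3 8 = Real.logb 3 (8 ^ 28) := by
    rw [Real.logb_pow]; norm_num
  rw [h, Real.logb_le_iff_le_rpow (by norm_num) (by positivity)]
  norm_num

theorem three_rpow_logb : (3 : ℝ) ^ Real.logb 3 8 = 8 :=
  Real.rpow_logb (by norm_num) (by norm_num) (by norm_num)

theorem logb_three_eight_pos : 0 < Real.logb 3 8 := Real.logb_pos (by norm_num) (by norm_num)

/-- The diameter of the ball used as a competitor. -/
noncomputable def testDiam : ℝ := √14515 / 81

theorem testDiam_sq : testDiam ^ 2 = 14515 / 6561 := by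
  rw [testDiam, div_pow, Real.sq_sqrt (by norm_num)]
  norm_num

theorem testDiam_pos : 0 < testDiam := by
  unfold testDiam
  positivity

/-- Since `729 · testDiam² = 14515/9`, having `t ≥ T` would give `√x ≤ D / testDiam` with `x =
9T/14515`. Raise this to the power `56 s`; as `x ≤ 1`, the exponent `28 s` on `x` may be enlarged to
53. -/
theorem massBound_of_rpow_le {D : ℝ} (hD : 0 ≤ D) {m : ℕ}
    (h : D ^ Real.logb 3 8 ≤ testDiam ^ Real.logb 3 8 * (m / 453)) :
    MassBound (729 * D ^ 2) m := by
  intro M T hmM hT hnum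
  by_contra! hle
  set s := Real.logb 3 8 with hs
  have hT0 : T ≠ 0 := by
    rintro rfl
    simp at hnum
  set x : ℝ := 9 * T / 14515 with hx
  have hx0 : 0 < x := by positivity
  have hx1 : x ≤ 1 := by
    rw [hx, div_le_one (by norm_num)]
    exact_mod_cast hT
  have h1 : √x ≤ D / testDiam := by
    refine Real.sqrt_le_iff.2 ⟨by have := testDiam_pos; positivity, ?_⟩
    rw [div_pow, testDiam_sq, hx]
    linarith
  have h2 : √x ^ s ≤ M / 453 := by
    calc √x ^ s ≤ (D / testDiam) ^ s :=
          Real.rpow_le_rpow (Real.sqrt_nonneg _) h1 logb_three_eight_pos.le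
      _ = D ^ s / testDiam ^ s := Real.div_rpow hD testDiam_pos.le _
      _ ≤ m / 453 := by
          rw [div_le_iff₀ (Real.rpow_pos_of_pos testDiam_pos _), mul_comm]
          exact h
      _ ≤ M / 453 := by gcongr
  have h3 : x ^ (53 : ℝ) ≤ (M / 453) ^ 56 := by
    calc x ^ (53 : ℝ) ≤ x ^ (28 * s) :=
          Real.rpow_le_rpow_of_exponent_ge hx0 hx1 logb_three_eight_le
      _ = (√x ^ s) ^ 56 := by
          rw [Real.sqrt_eq_rpow, ← Real.rpow_mul hx0.le, ← Real.rpow_natCast,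
            ← Real.rpow_mul hx0.le]
          congr 1
          push_cast
          ring
      _ ≤ (M / 453) ^ 56 := by gcongr
  have h4 : x ^ (53 : ℝ) = x ^ 53 := by
    rw [← Real.rpow_natCast]; norm_num
  rw [h4, hx, div_pow, div_pow, div_le_div_iff₀ (by positivity) (by positivity)] at h3
  have h5 : ((M : ℝ) ^ 56 * 14515 ^ 53) < (9 * T) ^ 53 * 453 ^ 56 := by exact_mod_cast hnum
  linarith

/-! ### The Cantor function and positivity of the Hausdorff measure -/

section CantorFunction

theorem cantorToBinary_succ (x : ℝ) (n : ℕ) :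
    (cantorToBinary x).get (n + 1) = (cantorToBinary (cantorStep x)).get n := by
  simp only [cantorToBinary, cantorSequence, Stream'.get_map, Stream'.get_succ_iterate]

theorem mem_cantorSet_cases {x : ℝ} (hx : x ∈ cantorSet) :
    x ∈ Set.Icc 0 (1 / 3) ∨ x ∈ Set.Icc (2 / 3) 1 := by
  rw [cantorSet_eq_union_halves] at hx
  rcases hx with ⟨y, hy, rfl⟩ | ⟨y, hy, rfl⟩
  all_goals
    have := cantorSet_subset_unitInterval hy
    obtain ⟨h0, h1⟩ := this
  · left; constructor <;> linarith
  · right; constructor <;> linarith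

/-- Points closer than 1/3 lie in the same half of the Cantor set, and the shift then multiplies
their distance by 3. -/
theorem cantorToBinary_eq_of_abs_sub_lt (n : ℕ) {x y : ℝ} (hx : x ∈ cantorSet)
    (hy : y ∈ cantorSet) (h : |x - y| < (3 ^ n)⁻¹) :
    ∀ i < n, (cantorToBinary x).get i = (cantorToBinary y).get i := by
  induction n generalizing x y with
  | zero => intro i hi; omega
  | succ n ih =>
    have hp : (0 : ℝ) < 3 ^ n := by positivity
    have h1 : (1 : ℝ) ≤ 3 ^ n := one_le_pow₀ (by norm_num)
    have h3 : |x - y| < 1 / 3 := by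
      refine h.trans_le ?_
      rw [pow_succ, mul_inv, one_div]
      exact mul_le_of_le_one_left (by norm_num) (inv_le_one_of_one_le₀ h1)
    have hiff : x ∈ Set.Icc (0 : ℝ) (1 / 3) ↔ y ∈ Set.Icc (0 : ℝ) (1 / 3) := by
      rw [abs_lt] at h3
      rcases mem_cantorSet_cases hx with hx' | hx' <;> rcases mem_cantorSet_cases hy with hy' | hy' <;>
        simp only [Set.mem_Icc] at hx' hy' ⊢ <;> constructor <;> rintro ⟨_, _⟩ <;>
        constructor <;> linarith
    intro i hi
    rcases i with _ | i
    · simp only [cantorToBinary, cantorSequence, Stream'.get_map, Stream'.get_zero_iterate, hiff]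
      by_cases hy' : y ∈ Set.Icc (0 : ℝ) (1 / 3) <;> simp only [hy', if_true, if_false]
    · rw [cantorToBinary_succ, cantorToBinary_succ]
      refine ih (cantorStep_mem_cantorSet hx) (cantorStep_mem_cantorSet hy) ?_ i (by omega)
      have : cantorStep x - cantorStep y = 3 * (x - y) := by
        simp only [cantorStep, hiff]
        split_ifs <;> ring
      rw [this, abs_mul, abs_of_pos (by norm_num : (0 : ℝ) < 3)]
      rw [pow_succ, mul_inv] at h
      linarith

/-- The Cantor function on the Cantor set. -/
noncomputable def cantorFunction (x : ℝ) : ℝ :=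
  Real.ofDigits (b := 2) fun n => cond ((cantorToBinary x).get n) 1 0

/-- If `3^-(n+1) < |x - y| ≤ 3^-n`, the first `n - 1` digits agree; one digit is lost because
agreement needs a strict inequality. The constant is 4 = 2^(n+1) / 2^(n-1). -/
theorem abs_cantorFunction_sub_le {x y : ℝ} (hx : x ∈ cantorSet) (hy : y ∈ cantorSet) :
    |cantorFunction x - cantorFunction y| ≤ 4 * |x - y| ^ Real.logb 3 2 := by
  rcases eq_or_ne x y with rfl | hne
  · simp only [sub_self, abs_zero]; positivity
  have hpos : 0 < |x - y| := abs_pos.2 (sub_ne_zero.2 hne)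
  have hle : |x - y| ≤ 1 := by
    obtain ⟨hx0, hx1⟩ := cantorSet_subset_unitInterval hx
    obtain ⟨hy0, hy1⟩ := cantorSet_subset_unitInterval hy
    rw [abs_le]
    constructor <;> linarith
  obtain ⟨n, hn1, hn2⟩ := exists_nat_pow_near_of_lt_one hpos hle (y := (1 / 3 : ℝ)) (by norm_num)
    (by norm_num)
  have hagree : |cantorFunction x - cantorFunction y| ≤ (2 ^ (n - 1))⁻¹ := by
    have := Real.abs_ofDigits_sub_ofDigits_le (b := 2) (n := n - 1)
      (x := fun n => cond ((cantorToBinary x).get n) 1 0)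
      (y := fun n => cond ((cantorToBinary y).get n) 1 0) (fun i hi => by
        have hlt : |x - y| < (3 ^ (n - 1))⁻¹ := by
          refine hn2.trans_lt ?_
          rw [one_div, inv_pow]
          have : (3 : ℝ) ^ (n - 1) < 3 ^ n := pow_lt_pow_right₀ (by norm_num) (by omega)
          exact inv_strictAnti₀ (by positivity) this
        simp only [cantorToBinary_eq_of_abs_sub_lt (n - 1) hx hy hlt i hi])
    exact_mod_cast this
  have hpow : ((2 : ℝ) ^ (n + 1))⁻¹ = ((1 / 3 : ℝ) ^ (n + 1)) ^ Real.logb 3 2 := by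
    rw [← Real.rpow_natCast, ← Real.rpow_natCast, ← Real.rpow_mul (by norm_num), mul_comm,
      Real.rpow_mul (by norm_num), one_div, Real.inv_rpow (by norm_num),
      Real.rpow_logb (by norm_num) (by norm_num) (by norm_num), Real.inv_rpow (by norm_num)]
  have hmono : ((1 / 3 : ℝ) ^ (n + 1)) ^ Real.logb 3 2 ≤ |x - y| ^ Real.logb 3 2 :=
    Real.rpow_le_rpow (by positivity) hn1.le (Real.logb_pos (by norm_num) (by norm_num)).le
  have hfour : ((2 : ℝ) ^ (n - 1))⁻¹ ≤ 4 * (2 ^ (n + 1))⁻¹ := by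
    rcases n with _ | n
    · norm_num
    · simp only [Nat.add_sub_cancel]
      rw [pow_succ, pow_succ]
      have : (0 : ℝ) < 2 ^ n := by positivity
      field_simp
      norm_num
  calc _ ≤ _ := hagree
    _ ≤ _ := hfour
    _ ≤ _ := by rw [hpow]; linarith

theorem exists_cantorFunction_eq {y : ℝ} (hy : y ∈ Set.Ico (0 : ℝ) 1) :
    ∃ x ∈ cantorSet, cantorFunction x = y := by
  set f : ℕ → Bool := fun n => decide (Real.digits y 2 n = 1) with hf
  refine ⟨cantorSetEquivNatToBool.symm f, (cantorSetEquivNatToBool.symm f).2, ?_⟩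
  have h : (cantorToBinary (cantorSetEquivNatToBool.symm f : ℝ)).get = f :=
    cantorSetEquivNatToBool.apply_symm_apply f
  rw [← Real.ofDigits_digits (b := 2) (by norm_num) hy, cantorFunction]
  congr 1
  funext n
  have hn : (cantorToBinary (cantorSetEquivNatToBool.symm f : ℝ)).get n = f n := congrFun h n
  rw [hn]
  change (bif decide (Real.digits y 2 n = 1) then (1 : Fin 2) else 0) = Real.digits y 2 n
  generalize Real.digits y 2 n = d
  revert d
  decide

end CantorFunction

/-- The coordinatewise Cantor function is Hölder of exponent `log_3 2` and its image contains
`[0,1)^3`. A null dust would therefore make a set of Lebesgue measure 1 null. -/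
theorem hausdorffMeasure_cantorProd_ne_zero : μH[Real.logb 3 8] (cantorProd 3) ≠ 0 := by
  intro h0
  set σ : NNReal := ⟨Real.logb 3 2, (Real.logb_pos (by norm_num) (by norm_num)).le⟩ with hσ
  have hσpos : 0 < σ := by
    rw [← NNReal.coe_pos]
    exact Real.logb_pos (by norm_num) (by norm_num)
  have hold : HolderOnWith 4 σ (fun (x : EuclideanSpace ℝ (Fin 3)) (k : Fin 3) =>
      cantorFunction (x k)) (cantorProd 3) := by
    intro x hx y hy
    rw [edist_pi_le_iff]
    intro k
    have h1 := abs_cantorFunction_sub_le (hx k) (hy k)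
    have h2 : |x k - y k| ≤ dist x y := by
      rw [dist_eq_norm]
      simpa using PiLp.norm_apply_le (x - y) k
    have h3 : dist (cantorFunction (x k)) (cantorFunction (y k)) ≤ 4 * dist x y ^ (σ : ℝ) := by
      rw [Real.dist_eq]
      refine h1.trans ?_
      have := Real.rpow_le_rpow (abs_nonneg _) h2 σ.2
      change _ ≤ 4 * dist x y ^ Real.logb 3 2
      change |x k - y k| ^ Real.logb 3 2 ≤ dist x y ^ Real.logb 3 2 at this
      linarith
    rw [edist_dist, edist_dist x y, ENNReal.ofReal_rpow_of_nonneg dist_nonneg σ.coe_nonneg]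
    refine (ENNReal.ofReal_le_ofReal h3).trans_eq ?_
    rw [ENNReal.ofReal_mul (by norm_num)]
    norm_num
  have hmeas := hold.hausdorffMeasure_image_le hσpos (d := 3) (by norm_num)
  have hexp : (σ : ℝ) * 3 = Real.logb 3 8 := by
    change Real.logb 3 2 * 3 = _
    rw [show (8 : ℝ) = 2 ^ 3 by norm_num, Real.logb_pow]
    push_cast
    ring
  rw [hexp, h0, mul_zero] at hmeas
  have hsub : Set.pi Set.univ (fun _ : Fin 3 => Set.Ico (0 : ℝ) 1) ⊆
      (fun (x : EuclideanSpace ℝ (Fin 3)) (k : Fin 3) => cantorFunction (x k)) '' cantorProd 3 := by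
    intro y hy
    choose f hf using fun k => exists_cantorFunction_eq (hy k (Set.mem_univ k))
    exact ⟨WithLp.toLp 2 f, fun k => (hf k).1, funext fun k => (hf k).2⟩
  have hvol := (measure_mono hsub).trans hmeas
  have h3 : (μH[(3 : ℝ)] : Measure (Fin 3 → ℝ)) = volume := by
    have := hausdorffMeasure_pi_real (ι := Fin 3)
    simpa using this
  rw [h3, Real.volume_pi_Ico] at hvol
  simp at hvol

/-! ### Basic cells, finiteness of the measure and the dimension -/

section Cells

/-- The left endpoints, in units of `3⁻ⁿ`, of the basic intervals of level `n` of the Cantor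
set. -/
def cantorPositions : ℕ → Finset ℕ
  | 0 => {0}
  | n + 1 => (cantorPositions n).image (3 * ·) ∪ (cantorPositions n).image (3 * · + 2)

theorem card_cantorPositions_le (n : ℕ) : (cantorPositions n).card ≤ 2 ^ n := by
  induction n with
  | zero => simp [cantorPositions]
  | succ n ih =>
    refine (Finset.card_union_le _ _).trans ?_
    have h1 := Finset.card_image_le (s := cantorPositions n) (f := (3 * ·))
    have h2 := Finset.card_image_le (s := cantorPositions n) (f := (3 * · + 2))
    rw [pow_succ]
    omega

theorem mem_cantorSet_iff (x : ℝ) : x ∈ cantorSet ↔ 3 * x ∈ cantorSet ∨ 3 * x - 2 ∈ cantorSet := by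
  conv_lhs => rw [cantorSet_eq_union_halves]
  constructor
  · rintro (⟨y, hy, rfl⟩ | ⟨y, hy, rfl⟩)
    · left; convert hy using 1; ring
    · right; convert hy using 1; ring
  · rintro (h | h)
    · exact Or.inl ⟨_, h, by ring⟩
    · exact Or.inr ⟨_, h, by ring⟩

theorem mem_cantorSet_iff_exists_position (n : ℕ) (x : ℝ) :
    x ∈ cantorSet ↔ ∃ p ∈ cantorPositions n, 3 ^ n * x - (p : ℕ) ∈ cantorSet := by
  induction n with
  | zero => simp [cantorPositions]
  | succ n ih =>
    rw [ih]
    simp only [cantorPositions, Finset.mem_union, Finset.mem_image]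
    constructor
    · rintro ⟨p, hp, hx⟩
      rw [mem_cantorSet_iff] at hx
      rcases hx with hx | hx
      · refine ⟨_, Or.inl ⟨p, hp, rfl⟩, ?_⟩
        convert hx using 1
        push_cast; ring
      · refine ⟨_, Or.inr ⟨p, hp, rfl⟩, ?_⟩
        convert hx using 1
        push_cast; ring
    · rintro ⟨_, ⟨p, hp, rfl⟩ | ⟨p, hp, rfl⟩, hx⟩ <;>
        refine ⟨p, hp, (mem_cantorSet_iff _).2 ?_⟩
      · left
        convert hx using 1
        push_cast; ring
      · right
        convert hx using 1
        push_cast; ring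

/-- The part of the Cantor dust in the triadic cube of side `3⁻ⁿ` at position `p`. -/
def cantorCell (n : ℕ) (p : Fin 3 → ℕ) : Set (EuclideanSpace ℝ (Fin 3)) :=
  {x | ∀ k, 3 ^ n * x k - p k ∈ cantorSet}

theorem mem_cantorProd_iff_exists_cell (n : ℕ) (x : EuclideanSpace ℝ (Fin 3)) :
    x ∈ cantorProd 3 ↔
      ∃ p ∈ Fintype.piFinset fun _ : Fin 3 => cantorPositions n, x ∈ cantorCell n p := by
  constructor
  · intro hx
    choose p hp hx using fun k => (mem_cantorSet_iff_exists_position n (x k)).1 (hx k)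
    exact ⟨p, Fintype.mem_piFinset.2 hp, hx⟩
  · rintro ⟨p, hp, hx⟩ k
    exact (mem_cantorSet_iff_exists_position n (x k)).2 ⟨p k, Fintype.mem_piFinset.1 hp k, hx k⟩

theorem cantorCell_eq_image (n : ℕ) (p : Fin 3 → ℕ) :
    cantorCell n p = (fun y => ((3 : ℝ) ^ n)⁻¹ • y) ''
      (IsometryEquiv.addRight (WithLp.toLp 2 fun k => (p k : ℝ)) '' cantorProd 3) := by
  ext x
  simp only [cantorCell, cantorProd, Set.mem_image, exists_exists_and_eq_and, Set.mem_ofPred_eq]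
  constructor
  · intro h
    refine ⟨WithLp.toLp 2 fun k => 3 ^ n * x k - p k, h, ?_⟩
    ext k
    simp only [IsometryEquiv.addRight_apply, PiLp.smul_apply, PiLp.add_apply, smul_eq_mul]
    field_simp
    ring
  · rintro ⟨y, hy, rfl⟩ k
    convert hy k using 1
    simp only [IsometryEquiv.addRight_apply, PiLp.smul_apply, PiLp.add_apply, smul_eq_mul]
    field_simp
    ring

theorem three_pow_rpow_logb (n : ℕ) : ((3 : ℝ≥0∞) ^ n)⁻¹ ^ Real.logb 3 8 = ((8 : ℝ≥0∞) ^ n)⁻¹ := by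
  have h : (3 : ℝ≥0∞) ^ Real.logb 3 8 = 8 := by
    have := congrArg ENNReal.ofReal three_rpow_logb
    rw [← ENNReal.ofReal_rpow_of_pos (by norm_num)] at this
    norm_num at this
    exact this
  rw [ENNReal.inv_rpow, ← ENNReal.rpow_natCast, ← ENNReal.rpow_mul, mul_comm, ENNReal.rpow_mul, h,
    ENNReal.rpow_natCast]

theorem hausdorffMeasure_cantorCell (n : ℕ) (p : Fin 3 → ℕ) :
    μH[Real.logb 3 8] (cantorCell n p) = ((8 : ℝ≥0∞) ^ n)⁻¹ * μH[Real.logb 3 8] (cantorProd 3) := by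
  rw [cantorCell_eq_image, Set.image_smul, Measure.hausdorffMeasure_smul₀ logb_three_eight_pos.le
    (by positivity), IsometryEquiv.hausdorffMeasure_image, ENNReal.smul_def, smul_eq_mul,
    ← three_pow_rpow_logb]
  congr 1
  rw [ENNReal.coe_rpow_of_nonneg _ logb_three_eight_pos.le]
  congr 1
  rw [nnnorm_inv, nnnorm_pow, ENNReal.coe_inv (pow_ne_zero _ (nnnorm_ne_zero_iff.2 (by norm_num)))]
  simp

theorem ediam_cantorCell (n : ℕ) (p : Fin 3 → ℕ) :
    Metric.ediam (cantorCell n p) = ((3 : ℝ≥0∞) ^ n)⁻¹ * Metric.ediam (cantorProd 3) := by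
  rw [cantorCell_eq_image, Set.image_smul, ediam_smul₀, IsometryEquiv.ediam_image,
    ENNReal.smul_def, smul_eq_mul]
  congr 1
  rw [nnnorm_inv, nnnorm_pow, ENNReal.coe_inv (pow_ne_zero _ (nnnorm_ne_zero_iff.2 (by norm_num)))]
  simp

end Cells

theorem isClosed_cantorProd (d : ℕ) : IsClosed (cantorProd d) := by
  have : cantorProd d = ⋂ k, (fun x : EuclideanSpace ℝ (Fin d) => x k) ⁻¹' cantorSet := by
    ext x; simp [cantorProd]
  rw [this]
  exact isClosed_iInter fun k => isClosed_cantorSet.preimage (by fun_prop)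

theorem dist_le_sqrt_three {x y : EuclideanSpace ℝ (Fin 3)} (hx : x ∈ unitCube 3)
    (hy : y ∈ unitCube 3) : dist x y ≤ √3 := by
  rw [EuclideanSpace.dist_eq]
  refine Real.sqrt_le_sqrt ?_
  calc ∑ k, dist (x k) (y k) ^ 2 ≤ ∑ k : Fin 3, (1 : ℝ) := by
        refine Finset.sum_le_sum fun k _ => ?_
        have h1 := hx k
        have h2 := hy k
        simp only [Set.mem_Icc] at h1 h2
        rw [Real.dist_eq, sq_abs]
        nlinarith
    _ = 3 := by simp

theorem cantorProd_subset_unitCube : cantorProd 3 ⊆ unitCube 3 :=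
  fun _ hx k => cantorSet_subset_unitInterval (hx k)

theorem ediam_cantorProd_le : Metric.ediam (cantorProd 3) ≤ ENNReal.ofReal √3 := by
  refine Metric.ediam_le fun x hx y hy => ?_
  rw [edist_dist]
  exact ENNReal.ofReal_le_ofReal
    (dist_le_sqrt_three (cantorProd_subset_unitCube hx) (cantorProd_subset_unitCube hy))

theorem ediam_cantorProd_ne_top : Metric.ediam (cantorProd 3) ≠ ∞ :=
  (ediam_cantorProd_le.trans_lt ENNReal.ofReal_lt_top).ne

/-- At level `n` there are at most `8^n` cells of diameter `3^-n |E|`, so the `s`-th powers of the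
diameters sum to at most `|E|^s`. -/
theorem hausdorffMeasure_cantorProd_ne_top : μH[Real.logb 3 8] (cantorProd 3) ≠ ∞ := by
  set Δ := Metric.ediam (cantorProd 3) with hΔ
  have hlim : Filter.Tendsto (fun n : ℕ => ((3 : ℝ≥0∞) ^ n)⁻¹ * Δ) Filter.atTop (nhds 0) := by
    have h := ENNReal.tendsto_pow_atTop_nhds_zero_of_lt_one (r := (3 : ℝ≥0∞)⁻¹) (by simp)
    have := ENNReal.Tendsto.mul_const h (Or.inr ediam_cantorProd_ne_top)
    simpa [ENNReal.inv_pow] using this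
  have h := Measure.hausdorffMeasure_le_liminf_sum
    (ι := fun n => {p // p ∈ Fintype.piFinset fun _ : Fin 3 => cantorPositions n})
    (Real.logb 3 8) (cantorProd 3) _ hlim (fun n p => cantorCell n p)
    (.of_forall fun n p => (ediam_cantorCell n p).le)
    (.of_forall fun n x hx => by
      obtain ⟨p, hp, hx⟩ := (mem_cantorProd_iff_exists_cell n x).1 hx
      exact Set.mem_iUnion.2 ⟨⟨p, hp⟩, hx⟩)
  refine (h.trans_lt ?_).ne
  refine lt_of_le_of_lt (b := Δ ^ Real.logb 3 8) ?_
    (ENNReal.rpow_lt_top_of_nonneg logb_three_eight_pos.le ediam_cantorProd_ne_top)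
  refine Filter.liminf_le_of_le (by isBoundedDefault) fun b hb => ?_
  obtain ⟨n, hn⟩ := hb.exists
  refine hn.trans ?_
  simp only [ediam_cantorCell, ENNReal.mul_rpow_of_nonneg _ _ logb_three_eight_pos.le,
    three_pow_rpow_logb, Finset.sum_const, Finset.card_univ, Fintype.card_coe, nsmul_eq_mul,
    Fintype.card_piFinset_const]
  rw [← mul_assoc]
  refine mul_le_of_le_one_left' ?_
  rw [← div_eq_mul_inv]
  refine ENNReal.div_le_of_le_mul ?_
  rw [one_mul]
  have := Nat.pow_le_pow_left (card_cantorPositions_le n) 3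
  rw [← pow_mul, mul_comm, pow_mul] at this
  exact_mod_cast this

theorem cantorDim_three : cantorDim 3 = Real.logb 3 8 := by
  have := dimH_of_hausdorffMeasure_ne_zero_ne_top (d := ⟨_, logb_three_eight_pos.le⟩)
    (s := cantorProd 3) hausdorffMeasure_cantorProd_ne_zero hausdorffMeasure_cantorProd_ne_top
  rw [cantorDim, this]
  rfl

/-! ### The normalized measure and the passage from sets to cells -/

/-- The normalized Hausdorff measure on the Cantor dust, as a measure. -/
noncomputable def cantorProb : Measure (EuclideanSpace ℝ (Fin 3)) :=
  (μH[Real.logb 3 8] (cantorProd 3))⁻¹ • (μH[Real.logb 3 8]).restrict (cantorProd 3)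

theorem cantorMeasure_three (A : Set (EuclideanSpace ℝ (Fin 3))) :
    cantorMeasure 3 A = cantorProb A := by
  rw [cantorMeasure, cantorDim_three, cantorProb, Measure.smul_apply,
    Measure.restrict_apply' (isClosed_cantorProd 3).measurableSet, smul_eq_mul, div_eq_mul_inv,
    mul_comm]

instance : IsProbabilityMeasure cantorProb := by
  constructor
  rw [← cantorMeasure_three, cantorMeasure, Set.univ_inter, cantorDim_three]
  exact ENNReal.div_self hausdorffMeasure_cantorProd_ne_zero hausdorffMeasure_cantorProd_ne_top

theorem cantorProb_inter (A : Set (EuclideanSpace ℝ (Fin 3))) :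
    cantorProb (A ∩ cantorProd 3) = cantorProb A := by
  rw [← cantorMeasure_three, ← cantorMeasure_three, cantorMeasure, cantorMeasure, Set.inter_assoc,
    Set.inter_self]

theorem cantorProb_cantorCell_le (n : ℕ) (p : Fin 3 → ℕ) :
    cantorProb (cantorCell n p) ≤ ((8 : ℝ≥0∞) ^ n)⁻¹ := by
  rw [← cantorMeasure_three, cantorMeasure, cantorDim_three]
  refine ENNReal.div_le_of_le_mul ?_
  rw [← hausdorffMeasure_cantorCell n p]
  exact measure_mono Set.inter_subset_left

/-- A set meeting the dust only in the cells listed in `P` has mass at most `#P / 8ⁿ`. -/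
theorem cantorProb_le_card_mul {ι : Type*} (n : ℕ) (P : Finset ι) (pos : ι → Fin 3 → ℕ)
    {A : Set (EuclideanSpace ℝ (Fin 3))}
    (h : ∀ x ∈ A, x ∈ cantorProd 3 → ∃ i ∈ P, x ∈ cantorCell n (pos i)) :
    cantorProb A ≤ P.card * ((8 : ℝ≥0∞) ^ n)⁻¹ := by
  rw [← cantorProb_inter]
  have hsub : A ∩ cantorProd 3 ⊆ ⋃ i ∈ P, cantorCell n (pos i) := by
    rintro x ⟨hA, hE⟩
    obtain ⟨i, hi, hx⟩ := h x hA hE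
    exact Set.mem_biUnion hi hx
  refine (measure_mono hsub).trans ((measure_biUnion_finset_le _ _).trans ?_)
  refine (Finset.sum_le_card_nsmul _ _ _ fun i _ => cantorProb_cantorCell_le n (pos i)).trans_eq ?_
  rw [nsmul_eq_mul]

theorem cantorMap_apply (i : Fin 3 → Fin 2) (x : EuclideanSpace ℝ (Fin 3)) (k : Fin 3) :
    cantorMap 3 i x k = x k / 3 + 2 / 3 * ((i k : ℕ) : ℝ) := by
  simp only [cantorMap, PiLp.add_apply, PiLp.smul_apply, smul_eq_mul]
  ring

theorem mem_basicCube_iff {i : Fin 3 → Fin 2} {x : EuclideanSpace ℝ (Fin 3)} :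
    x ∈ basicCube 3 i ↔
      ∀ k, 2 / 3 * ((i k : ℕ) : ℝ) ≤ x k ∧ x k ≤ 2 / 3 * ((i k : ℕ) : ℝ) + 1 / 3 := by
  constructor
  · rintro ⟨y, hy, rfl⟩ k
    have := hy k
    rw [Set.mem_Icc] at this
    rw [cantorMap_apply]
    constructor <;> linarith
  · intro h
    refine ⟨WithLp.toLp 2 fun k => 3 * x k - 2 * ((i k : ℕ) : ℝ), fun k => ?_, ?_⟩
    · have := h k
      simp only [Set.mem_Icc]
      constructor <;> linarith
    · ext k
      rw [cantorMap_apply]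
      ring

/-- The position, in units of `1 / 27`, of an interval of level 3 of the Cantor set: `v` tells the
third it lies in, and `j` numbers the intervals of that third, from the centre outwards. -/
def cellPos (v : Fin 2) (j : Fin 4) : ℕ := if v = 0 then 8 - cellOffset j else 18 + cellOffset j

theorem exists_cellPos_eq : ∀ p ∈ cantorPositions 3, ∃ v j, p = cellPos v j := by decide

theorem cellPos_bounds : ∀ v : Fin 2, ∀ j, 18 * (v : ℕ) ≤ cellPos v j ∧
    cellPos v j ≤ 18 * (v : ℕ) + 8 := by decide

/-- The intervals have length 1 in these units, so a gap between them adds 1 to the difference of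
their left endpoints. -/
theorem cellGap_cases : ∀ v v' c c', cellGap v v' c c' = 0 ∨
    cellGap v v' c c' + 1 + cellPos v c ≤ cellPos v' c' ∨
    cellGap v v' c c' + 1 + cellPos v' c' ≤ cellPos v c := by decide

theorem cellGap_sq_le {v v' : Fin 2} {c c' : Fin 4} {x y : ℝ}
    (hx : 27 * x - (cellPos v c : ℕ) ∈ cantorSet) (hy : 27 * y - (cellPos v' c' : ℕ) ∈ cantorSet) :
    (cellGap v v' c c' : ℝ) ^ 2 ≤ 729 * (x - y) ^ 2 := by
  obtain ⟨hx0, hx1⟩ := cantorSet_subset_unitInterval hx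
  obtain ⟨hy0, hy1⟩ := cantorSet_subset_unitInterval hy
  have h0 : (0 : ℝ) ≤ cellGap v v' c c' := Nat.cast_nonneg _
  have key : (cellGap v v' c c' : ℝ) ≤ |27 * (x - y)| := by
    rcases cellGap_cases v v' c c' with h | h | h
    · rw [h]; simp
    · have : (cellGap v v' c c' : ℝ) + 1 + cellPos v c ≤ cellPos v' c' := by exact_mod_cast h
      rw [le_abs]; right; linarith
    · have : (cellGap v v' c c' : ℝ) + 1 + cellPos v' c' ≤ cellPos v c := by exact_mod_cast h
      rw [le_abs]; left; linarith
  calc (cellGap v v' c c' : ℝ) ^ 2 ≤ |27 * (x - y)| ^ 2 := by gcongr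
    _ = 729 * (x - y) ^ 2 := by rw [sq_abs]; ring

theorem dist_sq_eq_sum (x y : EuclideanSpace ℝ (Fin 3)) :
    dist x y ^ 2 = ∑ k, (x k - y k) ^ 2 := by
  rw [EuclideanSpace.dist_eq, Real.sq_sqrt (by positivity)]
  simp only [Real.dist_eq, sq_abs]

theorem abs_sub_le_dist (x y : EuclideanSpace ℝ (Fin 3)) (k : Fin 3) : |x k - y k| ≤ dist x y := by
  rw [dist_eq_norm]
  simpa using PiLp.norm_apply_le (x - y) k

/-- The cell of level 3 of the cube `v` with index `c`. -/
def octantCell (v : Fin 3 → Fin 2) (c : Fin 3 → Fin 4) : Set (EuclideanSpace ℝ (Fin 3)) :=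
  cantorCell 3 fun k => cellPos (v k) (c k)

theorem octantCell_subset_basicCube (v : Fin 3 → Fin 2) (c : Fin 3 → Fin 4) :
    octantCell v c ⊆ basicCube 3 v := by
  refine fun x hx => mem_basicCube_iff.2 fun k => ?_
  obtain ⟨h0, h1⟩ := cantorSet_subset_unitInterval (hx k)
  obtain ⟨h2, h3⟩ := cellPos_bounds (v k) (c k)
  have h2' : (18 : ℝ) * ((v k : ℕ) : ℝ) ≤ cellPos (v k) (c k) := by exact_mod_cast h2
  have h3' : (cellPos (v k) (c k) : ℝ) ≤ 18 * ((v k : ℕ) : ℝ) + 8 := by exact_mod_cast h3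
  constructor <;> linarith

theorem exists_mem_octantCell {x : EuclideanSpace ℝ (Fin 3)} (hx : x ∈ cantorProd 3) :
    ∃ v c, x ∈ octantCell v c := by
  obtain ⟨p, hp, hx⟩ := (mem_cantorProd_iff_exists_cell 3 x).1 hx
  choose v c h using fun k => exists_cellPos_eq (p k) (Fintype.mem_piFinset.1 hp k)
  refine ⟨v, c, fun k => ?_⟩
  simp only [← h k]
  exact hx k

theorem basicCube_index_eq {v w : Fin 3 → Fin 2} {x : EuclideanSpace ℝ (Fin 3)}
    (hv : x ∈ basicCube 3 v) (hw : x ∈ basicCube 3 w) : v = w := by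
  funext k
  obtain ⟨h1, h2⟩ := mem_basicCube_iff.1 hv k
  obtain ⟨h3, h4⟩ := mem_basicCube_iff.1 hw k
  generalize v k = a at *
  generalize w k = b at *
  fin_cases a <;> fin_cases b <;> first | rfl | (exfalso; norm_num at h1 h2 h3 h4; linarith)

theorem numBasicMet_eq_card (A : Set (EuclideanSpace ℝ (Fin 3))) [DecidablePred fun i =>
    (A ∩ basicCube 3 i).Nonempty] :
    numBasicMet 3 A = (Finset.univ.filter fun i => (A ∩ basicCube 3 i).Nonempty).card := by
  rw [numBasicMet, ← Set.ncard_coe_finset]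
  congr 1
  ext i
  simp

/-- Sets with a small quotient do not meet the dust in exactly two, three or four cubes. -/
theorem false_of_numBasicMet {A : Set (EuclideanSpace ℝ (Fin 3))} {D : ℝ} (hAE : A ⊆ cantorProd 3)
    (hD : 0 ≤ D) (hdiam : ∀ x ∈ A, ∀ y ∈ A, dist x y ≤ D)
    (hmass : D ^ Real.logb 3 8 ≤
      testDiam ^ Real.logb 3 8 * (512 / 453 * (cantorProb A).toReal))
    (h2 : 2 ≤ numBasicMet 3 A) (h4 : numBasicMet 3 A ≤ 4) : False := by
  classical
  set occ : (Fin 3 → Fin 2) → Finset (Fin 3 → Fin 4) := fun v =>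
    Finset.univ.filter fun c => (A ∩ octantCell v c).Nonempty with hocc
  have hne : ∀ v, (occ v).Nonempty ↔ (A ∩ basicCube 3 v).Nonempty := by
    intro v
    constructor
    · rintro ⟨c, hc⟩
      obtain ⟨x, hxA, hx⟩ := (Finset.mem_filter.1 hc).2
      exact ⟨x, hxA, octantCell_subset_basicCube v c hx⟩
    · rintro ⟨x, hxA, hx⟩
      obtain ⟨w, c, hc⟩ := exists_mem_octantCell (hAE hxA)
      obtain rfl := basicCube_index_eq (octantCell_subset_basicCube w c hc) hx
      exact ⟨c, Finset.mem_filter.2 ⟨Finset.mem_univ _, x, hxA, hc⟩⟩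
  have hcard : (Finset.univ.filter fun v => (occ v).Nonempty).card = numBasicMet 3 A := by
    rw [numBasicMet_eq_card]
    simp only [hne]
  have hwithin : CellsWithin (729 * D ^ 2) occ := by
    intro v v' c hc c' hc'
    obtain ⟨x, hxA, hx⟩ := (Finset.mem_filter.1 hc).2
    obtain ⟨y, hyA, hy⟩ := (Finset.mem_filter.1 hc').2
    have hd := hdiam x hxA y hyA
    have h1 : dist x y ^ 2 ≤ D ^ 2 := by gcongr
    rw [dist_sq_eq_sum] at h1
    push_cast
    calc _ ≤ ∑ k, 729 * (x k - y k) ^ 2 := by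
          refine Finset.sum_le_sum fun k _ => cellGap_sq_le (c := c k) (c' := c' k) ?_ ?_
          · have := hx k; norm_num at this; exact this
          · have := hy k; norm_num at this; exact this
      _ ≤ 729 * D ^ 2 := by rw [← Finset.mul_sum]; linarith
  refine hwithin.false_of_card (hcard ▸ h2) (hcard ▸ h4) (massBound_of_rpow_le hD ?_)
  refine hmass.trans ?_
  have hprob : cantorProb A ≤ ((∑ v, (occ v).card : ℕ) : ℝ≥0∞) * ((8 : ℝ≥0∞) ^ 3)⁻¹ := by
    rw [← Finset.card_sigma]
    refine cantorProb_le_card_mul 3 _ (fun i k => cellPos (i.1 k) (i.2 k)) fun x hxA hxE => ?_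
    obtain ⟨v, c, hc⟩ := exists_mem_octantCell hxE
    exact ⟨⟨v, c⟩, Finset.mem_sigma.2 ⟨Finset.mem_univ _, Finset.mem_filter.2
      ⟨Finset.mem_univ _, x, hxA, hc⟩⟩, hc⟩
  have hreal : (cantorProb A).toReal ≤ (∑ v, (occ v).card : ℕ) / 512 := by
    refine (ENNReal.toReal_mono ?_ hprob).trans_eq ?_
    · exact ENNReal.mul_ne_top (ENNReal.natCast_ne_top _) (by simp)
    · rw [ENNReal.toReal_mul, ENNReal.toReal_natCast, ENNReal.toReal_inv]
      norm_num
      ring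
  have := testDiam_pos
  gcongr
  linarith

/-! ### The competitor ball -/

section TestBall

/-- The largest distance of a point of the interval of level 4 at position `p` from `1 / 2`, in
units of `1 / 162`. -/
def farEdge (p : ℕ) : ℕ := max (81 - 2 * p) (2 * p + 2 - 81)

theorem abs_sub_half_le {x : ℝ} {p : ℕ}
    (hx : 3 ^ 4 * x - (p : ℕ) ∈ cantorSet) : 162 * |x - 1 / 2| ≤ farEdge p := by
  obtain ⟨h0, h1⟩ := cantorSet_subset_unitInterval hx
  have h2 : (81 : ℝ) - 2 * p ≤ farEdge p := by
    have : 81 ≤ farEdge p + 2 * p := by unfold farEdge; omega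
    have : (81 : ℝ) ≤ farEdge p + 2 * p := by exact_mod_cast this
    linarith
  have h3 : (2 : ℝ) * p + 2 - 81 ≤ farEdge p := by
    have : 2 * p + 2 ≤ farEdge p + 81 := by unfold farEdge; omega
    have : (2 : ℝ) * p + 2 ≤ farEdge p + 81 := by exact_mod_cast this
    linarith
  rw [← abs_of_pos (by norm_num : (0 : ℝ) < 162), ← abs_mul, abs_le]
  constructor <;> linarith

/-- The cells of level 4 which may leave the ball used as a competitor. -/
def outerCells : Finset (ℕ × ℕ × ℕ) :=
  (cantorPositions 4 ×ˢ cantorPositions 4 ×ˢ cantorPositions 4).filter fun p =>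
    14515 < farEdge p.1 ^ 2 + farEdge p.2.1 ^ 2 + farEdge p.2.2 ^ 2

/-- In units of 1/162 the ball has squared radius 14515. At least 4096 - 472 = 3624 cells of level 4
lie inside it, and 3624/4096 = 453/512. -/
theorem card_outerCells : outerCells.card = 472 := by decide +kernel

/-- The ball about the centre of the unit cube used as a competitor. -/
def testBall : Set (EuclideanSpace ℝ (Fin 3)) :=
  Metric.closedBall (WithLp.toLp 2 fun _ => 1 / 2) (testDiam / 2)

theorem measurableSet_testBall : MeasurableSet testBall := Metric.isClosed_closedBall.measurableSet

theorem cantorProb_compl_testBall_le : cantorProb testBallᶜ ≤ 472 * ((8 : ℝ≥0∞) ^ 4)⁻¹ := by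
  refine (cantorProb_le_card_mul 4 outerCells (fun p => ![p.1, p.2.1, p.2.2]) ?_).trans_eq
    (by rw [card_outerCells]; norm_num)
  intro x hxB hxE
  obtain ⟨p, hp, hx⟩ := (mem_cantorProd_iff_exists_cell 4 x).1 hxE
  rw [Fintype.mem_piFinset] at hp
  refine ⟨(p 0, p 1, p 2), Finset.mem_filter.2 ⟨by simp [hp], ?_⟩, fun k => ?_⟩
  · by_contra! hle
    refine hxB ?_
    rw [testBall, Metric.mem_closedBall]
    refine abs_le_of_sq_le_sq' ?_ (by have := testDiam_pos; positivity) |>.2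
    rw [div_pow, testDiam_sq, dist_sq_eq_sum, Fin.sum_univ_three]
    have hk : ∀ k, 162 ^ 2 * (x k - 1 / 2) ^ 2 ≤ (farEdge (p k) : ℝ) ^ 2 := fun k => by
      have := abs_sub_half_le (hx k)
      calc 162 ^ 2 * (x k - 1 / 2) ^ 2 = (162 * |x k - 1 / 2|) ^ 2 := by rw [mul_pow, sq_abs]
        _ ≤ _ := by gcongr
    have h0 := hk 0
    have h1 := hk 1
    have h2 := hk 2
    have hle' : (farEdge (p 0) : ℝ) ^ 2 + farEdge (p 1) ^ 2 + farEdge (p 2) ^ 2 ≤ 14515 := by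
      exact_mod_cast hle
    simp only
    linarith
  · fin_cases k
    exacts [hx 0, hx 1, hx 2]

theorem le_cantorProb_testBall : 453 / 512 ≤ (cantorProb testBall).toReal := by
  have h := prob_add_prob_compl (μ := cantorProb) measurableSet_testBall
  have h1 : (cantorProb testBall).toReal + (cantorProb testBallᶜ).toReal = 1 := by
    rw [← ENNReal.toReal_add (measure_ne_top _ _) (measure_ne_top _ _), h, ENNReal.toReal_one]
  have h2 : (cantorProb testBallᶜ).toReal ≤ 472 / 4096 := by
    refine (ENNReal.toReal_mono (ENNReal.mul_ne_top (by norm_num) (by simp))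
      cantorProb_compl_testBall_le).trans_eq ?_
    rw [ENNReal.toReal_mul, ENNReal.toReal_inv]
    norm_num
  linarith

end TestBall

/-! ### The gap constant, the diameter of the dust and admissibility -/

section Gap

theorem setDist_le {M : Type*} [MetricSpace M] {X Y : Set M} {x y : M} (hx : x ∈ X) (hy : y ∈ Y) :
    setDist X Y ≤ dist x y :=
  csInf_le ⟨0, by rintro _ ⟨x, -, y, -, rfl⟩; exact dist_nonneg⟩ ⟨x, hx, y, hy, rfl⟩

theorem zero_mem_cantorProd : (0 : EuclideanSpace ℝ (Fin 3)) ∈ cantorProd 3 :=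
  fun _ => zero_mem_cantorSet

theorem image_cantorMap_subset_basicCube (i : Fin 3 → Fin 2) :
    cantorMap 3 i '' cantorProd 3 ⊆ basicCube 3 i :=
  Set.image_mono cantorProd_subset_unitCube

theorem third_le_dist {i j : Fin 3 → Fin 2} (hij : i ≠ j) {x y : EuclideanSpace ℝ (Fin 3)}
    (hx : x ∈ basicCube 3 i) (hy : y ∈ basicCube 3 j) : 1 / 3 ≤ dist x y := by
  obtain ⟨k, hk⟩ := Function.ne_iff.1 hij
  refine le_trans ?_ (abs_sub_le_dist x y k)
  obtain ⟨h1, h2⟩ := mem_basicCube_iff.1 hx k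
  obtain ⟨h3, h4⟩ := mem_basicCube_iff.1 hy k
  rw [le_abs]
  generalize i k = a at *
  generalize j k = b at *
  fin_cases a <;> fin_cases b <;>
    first | exact absurd rfl hk | (norm_num at h1 h2 h3 h4; left; linarith) |
      (norm_num at h1 h2 h3 h4; right; linarith)

theorem third_le_cantorGap : 1 / 3 ≤ cantorGap 3 := by
  have : Nonempty {p : (Fin 3 → Fin 2) × (Fin 3 → Fin 2) // p.1 ≠ p.2} :=
    ⟨⟨(0, 1), by decide⟩⟩
  refine le_ciInf fun p => le_csInf ?_ ?_
  · exact ⟨_, _, Set.mem_image_of_mem _ zero_mem_cantorProd, _,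
      Set.mem_image_of_mem _ zero_mem_cantorProd, rfl⟩
  · rintro _ ⟨x, hx, y, hy, rfl⟩
    exact third_le_dist p.2 (image_cantorMap_subset_basicCube _ hx)
      (image_cantorMap_subset_basicCube _ hy)

/-- A crude bound suffices: it only serves to make the ball admissible. The points used are the
images of the origin in two neighbouring cubes. -/
theorem cantorGap_le : cantorGap 3 ≤ 2 / 3 := by
  refine (ciInf_le (Set.finite_range _).bddBelow ⟨(0, fun k => if k = 0 then 1 else 0), by decide⟩).trans ?_
  refine (setDist_le (Set.mem_image_of_mem _ zero_mem_cantorProd)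
    (Set.mem_image_of_mem _ zero_mem_cantorProd)).trans ?_
  refine abs_le_of_sq_le_sq' ?_ (by norm_num) |>.2
  rw [dist_sq_eq_sum, Fin.sum_univ_three]
  simp only [cantorMap_apply]
  norm_num

theorem one_mem_cantorSet : (1 : ℝ) ∈ cantorSet := by
  refine Set.mem_iInter.2 fun n => ?_
  induction n with
  | zero => simp
  | succ n ih =>
    rw [preCantorSet_succ]
    exact Or.inr ⟨1, ih, by norm_num⟩

theorem ediam_cantorProd : Metric.ediam (cantorProd 3) = ENNReal.ofReal √3 := by
  refine ediam_cantorProd_le.antisymm ?_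
  have h : (WithLp.toLp 2 fun _ => 1 : EuclideanSpace ℝ (Fin 3)) ∈ cantorProd 3 :=
    fun _ => one_mem_cantorSet
  refine le_trans (le_of_eq ?_) (Metric.edist_le_ediam_of_mem zero_mem_cantorProd h)
  rw [edist_dist, EuclideanSpace.dist_eq]
  congr 2
  simp [Real.dist_eq]

end Gap

theorem testBall_mem_admissibleSets : testBall ∈ admissibleSets 3 := by
  refine ⟨convex_closedBall _ _, ?_, ?_⟩
  · refine (ENNReal.ofReal_le_ofReal cantorGap_le).trans ?_
    have hr : (1 / 3 : ℝ) ^ 2 ≤ (testDiam / 2) ^ 2 := by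
      rw [div_pow testDiam, testDiam_sq]; norm_num
    have h1 : (WithLp.toLp 2 fun k => if k = 0 then 1 / 6 else 1 / 2 : EuclideanSpace ℝ (Fin 3)) ∈ testBall := by
      refine Metric.mem_closedBall.2 (abs_le_of_sq_le_sq' ((le_of_eq ?_).trans hr)
        (by have := testDiam_pos; positivity)).2
      rw [dist_sq_eq_sum, Fin.sum_univ_three]
      norm_num [show (2 : Fin 3) ≠ 0 by decide]
    have h2 : (WithLp.toLp 2 fun k => if k = 0 then 5 / 6 else 1 / 2 : EuclideanSpace ℝ (Fin 3)) ∈ testBall := by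
      refine Metric.mem_closedBall.2 (abs_le_of_sq_le_sq' ((le_of_eq ?_).trans hr)
        (by have := testDiam_pos; positivity)).2
      rw [dist_sq_eq_sum, Fin.sum_univ_three]
      norm_num [show (2 : Fin 3) ≠ 0 by decide]
    refine le_trans (ENNReal.ofReal_le_ofReal ?_)
      ((edist_dist _ _).symm.le.trans (Metric.edist_le_ediam_of_mem h1 h2))
    have := abs_sub_le_dist (WithLp.toLp 2 fun k => if k = 0 then 1 / 6 else 1 / 2 : EuclideanSpace ℝ (Fin 3))
      (WithLp.toLp 2 fun k => if k = 0 then 5 / 6 else 1 / 2) 0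
    refine le_trans ?_ this
    norm_num
  · rw [ediam_cantorProd]
    refine Metric.ediam_le fun x hx y hy => ?_
    rw [edist_dist]
    refine ENNReal.ofReal_le_ofReal ?_
    have h := dist_triangle_right x y (WithLp.toLp 2 fun _ => 1 / 2)
    have hx' := Metric.mem_closedBall.1 hx
    have hy' := Metric.mem_closedBall.1 hy
    have h3 : testDiam ≤ √3 := Real.le_sqrt_of_sq_le (by rw [testDiam_sq]; norm_num)
    linarith

theorem ediam_testBall_le : Metric.ediam testBall ≤ ENNReal.ofReal testDiam := by
  refine Metric.ediam_le fun x hx y hy => ?_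
  rw [edist_dist]
  refine ENNReal.ofReal_le_ofReal ?_
  have h := dist_triangle_right x y (WithLp.toLp 2 fun _ => 1 / 2)
  have hx' := Metric.mem_closedBall.1 hx
  have hy' := Metric.mem_closedBall.1 hy
  linarith

theorem diamRatio_three (A : Set (EuclideanSpace ℝ (Fin 3))) :
    diamRatio 3 A = Metric.ediam A ^ Real.logb 3 8 / cantorProb A := by
  rw [diamRatio, cantorDim_three, cantorMeasure_three]

theorem diamRatio_testBall_le :
    diamRatio 3 testBall ≤ ENNReal.ofReal (testDiam ^ Real.logb 3 8 * (512 / 453)) := by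
  rw [diamRatio_three]
  have h1 : ENNReal.ofReal (453 / 512) ≤ cantorProb testBall :=
    ENNReal.ofReal_le_of_le_toReal le_cantorProb_testBall
  refine (ENNReal.div_le_div (ENNReal.rpow_le_rpow ediam_testBall_le logb_three_eight_pos.le)
    h1).trans_eq ?_
  rw [ENNReal.ofReal_rpow_of_pos testDiam_pos, ← ENNReal.ofReal_div_of_pos (by norm_num)]
  congr 1
  ring

/-! ### Inequalities for admissible sets -/

section Competitors

variable {A : Set (EuclideanSpace ℝ (Fin 3))}

theorem ediam_ne_top_of_mem (hA : A ∈ admissibleSets 3) : Metric.ediam A ≠ ∞ :=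
  (hA.2.2.trans_lt ediam_cantorProd_ne_top.lt_top).ne

theorem third_le_diam_of_mem (hA : A ∈ admissibleSets 3) : 1 / 3 ≤ (Metric.ediam A).toReal :=
  third_le_cantorGap.trans ((ENNReal.ofReal_le_iff_le_toReal (ediam_ne_top_of_mem hA)).1 hA.2.1)

theorem dist_le_diam_of_mem (hA : A ∈ admissibleSets 3) {x y : EuclideanSpace ℝ (Fin 3)}
    (hx : x ∈ A) (hy : y ∈ A) : dist x y ≤ (Metric.ediam A).toReal := by
  have h := Metric.edist_le_ediam_of_mem hx hy
  rw [edist_dist] at h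
  exact (ENNReal.ofReal_le_iff_le_toReal (ediam_ne_top_of_mem hA)).1 h

/-- The diameter is at least 1/3, so zero mass gives the quotient `∞` and not the degenerate 0/0. -/
theorem cantorProb_pos_of_diamRatio (hA : A ∈ admissibleSets 3) (h : diamRatio 3 A ≠ ∞) :
    0 < (cantorProb A).toReal := by
  refine ENNReal.toReal_pos (fun h0 => h ?_) (measure_ne_top _ _)
  rw [diamRatio_three, h0]
  refine ENNReal.div_zero fun hz => ?_
  rw [ENNReal.rpow_eq_zero_iff_of_pos logb_three_eight_pos] at hz
  have := third_le_diam_of_mem hA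
  rw [hz] at this
  norm_num at this

theorem diamRatio_eq_ofReal (hA : A ∈ admissibleSets 3) (h : 0 < (cantorProb A).toReal) :
    diamRatio 3 A =
      ENNReal.ofReal ((Metric.ediam A).toReal ^ Real.logb 3 8 / (cantorProb A).toReal) := by
  have hD : 0 < (Metric.ediam A).toReal := by linarith [third_le_diam_of_mem hA]
  rw [diamRatio_three, ENNReal.ofReal_div_of_pos h, ENNReal.ofReal_toReal (measure_ne_top _ _),
    ← ENNReal.ofReal_rpow_of_pos hD, ENNReal.ofReal_toReal (ediam_ne_top_of_mem hA)]

/-- The inequality satisfied by sets which are at least as good as the test ball. -/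
theorem rpow_diam_le (hA : A ∈ admissibleSets 3) (h : diamRatio 3 A ≤ diamRatio 3 testBall) :
    (Metric.ediam A).toReal ^ Real.logb 3 8 ≤
      testDiam ^ Real.logb 3 8 * (512 / 453 * (cantorProb A).toReal) := by
  have h1 := h.trans diamRatio_testBall_le
  have hpos := cantorProb_pos_of_diamRatio hA (h1.trans_lt ENNReal.ofReal_lt_top).ne
  rw [diamRatio_eq_ofReal hA hpos] at h1
  have h2 := (ENNReal.ofReal_le_ofReal_iff
    (by have := Real.rpow_pos_of_pos testDiam_pos (Real.logb 3 8); positivity)).1 h1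
  rw [div_le_iff₀ hpos] at h2
  linarith

end Competitors

/-! ### Self-similarity and cube counts -/

section Similarity

variable {A B : Set (EuclideanSpace ℝ (Fin 3))} {i : Fin 3 → Fin 2}

theorem cantorMap_image_eq (i : Fin 3 → Fin 2) (B : Set (EuclideanSpace ℝ (Fin 3))) :
    cantorMap 3 i '' B = (fun y => (3 : ℝ)⁻¹ • y) ''
      (IsometryEquiv.addRight (WithLp.toLp 2 fun k => 2 * ((i k : ℕ) : ℝ)) '' B) := by
  rw [Set.image_image]
  refine Set.image_congr fun x _ => ?_
  ext k
  rw [cantorMap_apply]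
  simp only [IsometryEquiv.addRight_apply, PiLp.smul_apply, PiLp.add_apply, smul_eq_mul]
  ring

theorem ediam_cantorMap_image (i : Fin 3 → Fin 2) (B : Set (EuclideanSpace ℝ (Fin 3))) :
    Metric.ediam (cantorMap 3 i '' B) = 3⁻¹ * Metric.ediam B := by
  rw [cantorMap_image_eq, Set.image_smul, ediam_smul₀, IsometryEquiv.ediam_image,
    ENNReal.smul_def, smul_eq_mul, nnnorm_inv, ENNReal.coe_inv (nnnorm_ne_zero_iff.2 (by norm_num))]
  simp

theorem hausdorffMeasure_cantorMap_image (i : Fin 3 → Fin 2)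
    (B : Set (EuclideanSpace ℝ (Fin 3))) :
    μH[Real.logb 3 8] (cantorMap 3 i '' B) = 8⁻¹ * μH[Real.logb 3 8] B := by
  have h := three_pow_rpow_logb 1
  rw [pow_one, pow_one] at h
  rw [cantorMap_image_eq, Set.image_smul, Measure.hausdorffMeasure_smul₀ logb_three_eight_pos.le
    (by positivity), IsometryEquiv.hausdorffMeasure_image, ENNReal.smul_def, smul_eq_mul, ← h]
  congr 1
  rw [ENNReal.coe_rpow_of_nonneg _ logb_three_eight_pos.le]
  congr 1
  rw [nnnorm_inv, ENNReal.coe_inv (nnnorm_ne_zero_iff.2 (by norm_num))]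
  simp

theorem cantorMap_surjective (i : Fin 3 → Fin 2) : Function.Surjective (cantorMap 3 i) := by
  intro x
  refine ⟨WithLp.toLp 2 fun k => 3 * x k - 2 * ((i k : ℕ) : ℝ), ?_⟩
  ext k
  rw [cantorMap_apply]
  ring

theorem ediam_cantorMap_preimage (i : Fin 3 → Fin 2) (A : Set (EuclideanSpace ℝ (Fin 3))) :
    Metric.ediam (cantorMap 3 i ⁻¹' A) = 3 * Metric.ediam A := by
  conv_rhs => rw [← Set.image_preimage_eq A (cantorMap_surjective i), ediam_cantorMap_image,
    ← mul_assoc, ENNReal.mul_inv_cancel (by norm_num) (by norm_num), one_mul]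

theorem cantorMap_mem_cantorProd {x : EuclideanSpace ℝ (Fin 3)} (hx : x ∈ cantorProd 3)
    (i : Fin 3 → Fin 2) : cantorMap 3 i x ∈ cantorProd 3 := by
  intro k
  rw [cantorMap_apply, mem_cantorSet_iff]
  have := hx k
  rcases Fin.exists_fin_two.1 ⟨i k, rfl⟩ with h | h <;> rw [h]
  · left; convert this using 1; simp; ring
  · right; convert this using 1; simp; ring

theorem cantorProd_inter_basicCube (i : Fin 3 → Fin 2) :
    cantorProd 3 ∩ basicCube 3 i = cantorMap 3 i '' cantorProd 3 := by
  refine Set.Subset.antisymm ?_ ?_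
  · rintro _ ⟨hE, x, hx, rfl⟩
    refine ⟨x, fun k => ?_, rfl⟩
    have h1 := hE k
    have h2 := hx k
    rw [cantorMap_apply, mem_cantorSet_iff] at h1
    rw [Set.mem_Icc] at h2
    rcases Fin.exists_fin_two.1 ⟨i k, rfl⟩ with h | h <;> rw [h] at h1
    · rcases h1 with h1 | h1
      · convert h1 using 1; simp; ring
      · have := (cantorSet_subset_unitInterval h1).1
        simp only [Fin.val_zero, Nat.cast_zero] at this
        linarith
    · rcases h1 with h1 | h1
      · have h3 := (cantorSet_subset_unitInterval h1).2
        simp only [Fin.val_one, Nat.cast_one] at h3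
        have h4 : x k ≤ 0 := by linarith
        have h5 : x k = 0 := le_antisymm h4 h2.1
        rw [h5]
        exact zero_mem_cantorSet
      · convert h1 using 1; simp; ring
  · rintro _ ⟨x, hx, rfl⟩
    exact ⟨cantorMap_mem_cantorProd hx i, x, cantorProd_subset_unitCube hx, rfl⟩

/-- The trace of `A` is the image under `cantorMap` of the trace of the preimage, and the similarity
scales the measure by `3^-s = 1/8`. -/
theorem cantorProb_preimage (h : A ∩ cantorProd 3 ⊆ basicCube 3 i) :
    cantorProb (cantorMap 3 i ⁻¹' A) = 8 * cantorProb A := by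
  have himg : A ∩ cantorProd 3 = cantorMap 3 i '' (cantorMap 3 i ⁻¹' A ∩ cantorProd 3) := by
    rw [Set.image_preimage_inter, ← cantorProd_inter_basicCube, ← Set.inter_assoc]
    exact (Set.inter_eq_left.2 h).symm
  rw [← cantorMeasure_three, ← cantorMeasure_three, cantorMeasure, cantorMeasure, cantorDim_three,
    himg, hausdorffMeasure_cantorMap_image, mul_div_assoc, ← mul_assoc,
    ENNReal.mul_inv_cancel (by norm_num) (by norm_num), one_mul]

theorem cantorProb_le_of_subset_basicCube (h : A ∩ cantorProd 3 ⊆ basicCube 3 i) :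
    (cantorProb A).toReal ≤ 1 / 8 := by
  have h1 : (8 * cantorProb A).toReal ≤ 1 := by
    rw [← cantorProb_preimage h]
    exact ENNReal.toReal_mono (by norm_num) prob_le_one
  rw [ENNReal.toReal_mul] at h1
  norm_num at h1
  linarith

end Similarity

section Counting

variable {A B : Set (EuclideanSpace ℝ (Fin 3))}

theorem numBasicMet_mono (h : A ⊆ B) : numBasicMet 3 A ≤ numBasicMet 3 B :=
  Set.ncard_le_ncard (fun _ hi => hi.mono (Set.inter_subset_inter_left _ h)) (Set.toFinite _)

theorem exists_mem_basicCube {x : EuclideanSpace ℝ (Fin 3)} (hx : x ∈ cantorProd 3) :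
    ∃ i, x ∈ basicCube 3 i := by
  obtain ⟨v, c, h⟩ := exists_mem_octantCell hx
  exact ⟨v, octantCell_subset_basicCube v c h⟩

theorem subset_basicCube_of_numBasicMet_le_one (hA : A ⊆ cantorProd 3) (h : numBasicMet 3 A ≤ 1) :
    ∃ i, A ⊆ basicCube 3 i := by
  rcases A.eq_empty_or_nonempty with rfl | ⟨x, hx⟩
  · exact ⟨0, Set.empty_subset _⟩
  obtain ⟨i, hi⟩ := exists_mem_basicCube (hA hx)
  refine ⟨i, fun y hy => ?_⟩
  obtain ⟨j, hj⟩ := exists_mem_basicCube (hA hy)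
  rwa [(Set.ncard_le_one_iff (Set.toFinite _)).1 h ⟨x, hx, hi⟩ ⟨y, hy, hj⟩]

theorem numBasicMet_le_four {k : Fin 3} {a : Fin 2}
    (h : ∀ v, (A ∩ basicCube 3 v).Nonempty → v k = a) : numBasicMet 3 A ≤ 4 := by
  have hcard : ∀ (k : Fin 3) (a : Fin 2),
      (Finset.univ.filter fun v : Fin 3 → Fin 2 => v k = a).card = 4 := by decide
  rw [← hcard k a, ← Set.ncard_coe_finset]
  exact Set.ncard_le_ncard (fun v hv => by simpa using h v hv) (Set.toFinite _)

end Counting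

/-! ### Magnification -/

theorem three_le_two_mul_logb : 3 ≤ 2 * Real.logb 3 8 := by
  have h : (2 : ℝ) * Real.logb 3 8 = Real.logb 3 (8 ^ 2) := by
    rw [Real.logb_pow]; norm_num
  rw [h, Real.le_logb_iff_rpow_le (by norm_num) (by positivity)]
  norm_num

/-- The hypothesis is the competitor inequality with the mass bounded by 1. For `x = (5/3) /
testDiam ≥ 1` and `s ≥ 3/2` it would give `x^6 ≤ (512/453)^4`, which is false. -/
theorem lt_five_thirds_of_rpow_le {D : ℝ}
    (h : D ^ Real.logb 3 8 ≤ testDiam ^ Real.logb 3 8 * (512 / 453)) : D < 5 / 3 := by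
  by_contra! hD
  have ht := testDiam_pos
  set x := (5 / 3) / testDiam with hx
  have hx0 : 0 < x := by positivity
  have hxsq : x ^ 2 = 25 / 9 * (6561 / 14515) := by
    rw [hx, div_pow, testDiam_sq]; norm_num
  have hx1 : 1 ≤ x := by
    have : (1 : ℝ) ^ 2 ≤ x ^ 2 := by rw [hxsq]; norm_num
    exact abs_le_of_sq_le_sq' this hx0.le |>.2
  have h1 : x ^ Real.logb 3 8 ≤ 512 / 453 := by
    rw [hx, Real.div_rpow (by norm_num) ht.le, div_le_iff₀ (Real.rpow_pos_of_pos ht _), mul_comm]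
    exact (Real.rpow_le_rpow (by norm_num) hD logb_three_eight_pos.le).trans h
  have h2 : x ^ 6 ≤ (x ^ Real.logb 3 8) ^ 4 := by
    rw [← Real.rpow_natCast, ← Real.rpow_natCast, ← Real.rpow_mul hx0.le]
    refine Real.rpow_le_rpow_of_exponent_le hx1 ?_
    push_cast
    linarith [three_le_two_mul_logb]
  have h3 : (x ^ Real.logb 3 8) ^ 4 ≤ (512 / 453) ^ 4 := by gcongr
  have h4 : x ^ 6 = (x ^ 2) ^ 3 := by ring
  rw [h4, hxsq] at h2
  norm_num at h2 h3
  linarith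

/-- A set of mass at most 1/8 satisfying the competitor inequality thus has diameter below 1. -/
theorem testDiam_rpow_lt : testDiam ^ Real.logb 3 8 * (512 / 453 * (1 / 8)) < 1 := by
  have h1 : 1 ≤ testDiam := by
    have : (1 : ℝ) ^ 2 ≤ testDiam ^ 2 := by rw [testDiam_sq]; norm_num
    exact abs_le_of_sq_le_sq' this testDiam_pos.le |>.2
  have h2 : testDiam ^ Real.logb 3 8 ≤ testDiam ^ (2 : ℝ) :=
    Real.rpow_le_rpow_of_exponent_le h1 (by linarith [logb_three_eight_le])
  rw [Real.rpow_two, testDiam_sq] at h2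
  linarith

section Magnification

variable {A : Set (EuclideanSpace ℝ (Fin 3))} {i : Fin 3 → Fin 2} {D : ℝ}

/-- A good set whose trace on the dust lies in one cube is small, and its magnification meets at
least five cubes. -/
theorem magnify (hD : 1 / 3 ≤ D) (hdiam : ∀ x ∈ A, ∀ y ∈ A, dist x y ≤ D)
    (hmass : D ^ Real.logb 3 8 ≤
      testDiam ^ Real.logb 3 8 * (512 / 453 * (cantorProb A).toReal))
    (hi : A ∩ cantorProd 3 ⊆ basicCube 3 i) :
    D < 5 / 9 ∧ 5 ≤ numBasicMet 3 (cantorMap 3 i ⁻¹' A ∩ cantorProd 3) := by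
  set B := cantorMap 3 i ⁻¹' A ∩ cantorProd 3 with hB
  have hprob : (cantorProb B).toReal = 8 * (cantorProb A).toReal := by
    rw [hB, cantorProb_inter, cantorProb_preimage hi, ENNReal.toReal_mul]
    norm_num
  have hBE : B ⊆ cantorProd 3 := Set.inter_subset_right
  have hmassB : (3 * D) ^ Real.logb 3 8 ≤
      testDiam ^ Real.logb 3 8 * (512 / 453 * (cantorProb B).toReal) := by
    rw [hprob, Real.mul_rpow (by norm_num) (by linarith), three_rpow_logb]
    linarith
  have ht := Real.rpow_pos_of_pos testDiam_pos (Real.logb 3 8)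
  have hdiamB : ∀ x ∈ B, ∀ y ∈ B, dist x y ≤ 3 * D := by
    intro x hx y hy
    have h1 := hdiam _ hx.1 _ hy.1
    refine abs_le_of_sq_le_sq' ?_ (by linarith) |>.2
    have h2 : dist (cantorMap 3 i x) (cantorMap 3 i y) ^ 2 ≤ D ^ 2 := by gcongr
    rw [dist_sq_eq_sum] at h2 ⊢
    have h3 : ∑ k, (x k - y k) ^ 2 =
        9 * ∑ k, (cantorMap 3 i x k - cantorMap 3 i y k) ^ 2 := by
      rw [Finset.mul_sum]
      refine Finset.sum_congr rfl fun k _ => ?_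
      rw [cantorMap_apply, cantorMap_apply]
      ring
    rw [h3]
    linarith
  clear_value B
  constructor
  · have : (cantorProb B).toReal ≤ 1 := ENNReal.toReal_mono (by norm_num) prob_le_one
    have := lt_five_thirds_of_rpow_le (hmassB.trans (by gcongr; linarith))
    linarith
  · by_contra! h5
    refine false_of_numBasicMet hBE (by linarith) hdiamB hmassB ?_ (by omega)
    -- A trace again in one cube would have mass at most 1/8, whereas `3 * D ≥ 1`.
    by_contra! h2
    obtain ⟨j, hj⟩ := subset_basicCube_of_numBasicMet_le_one hBE (by omega)
    have h8 := cantorProb_le_of_subset_basicCube (Set.inter_subset_left.trans hj)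
    have h1 : 1 ≤ (3 * D) ^ Real.logb 3 8 :=
      Real.one_le_rpow (by linarith) logb_three_eight_pos.le
    have h9 : testDiam ^ Real.logb 3 8 * (512 / 453 * (cantorProb B).toReal) ≤
        testDiam ^ Real.logb 3 8 * (512 / 453 * (1 / 8)) := by gcongr
    linarith [testDiam_rpow_lt]

/-- A good set meeting two cubes meets five. -/
theorem five_le_numBasicMet (hD : 1 / 3 ≤ D) (hdiam : ∀ x ∈ A, ∀ y ∈ A, dist x y ≤ D)
    (hmass : D ^ Real.logb 3 8 ≤
      testDiam ^ Real.logb 3 8 * (512 / 453 * (cantorProb A).toReal))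
    (h2 : 2 ≤ numBasicMet 3 A) : 5 ≤ numBasicMet 3 A := by
  by_contra! h5
  have hmono := numBasicMet_mono (A := A ∩ cantorProd 3) (B := A) Set.inter_subset_left
  -- The set may touch several cubes while its trace on the dust stays in one; only the trace is
  -- controlled by the cell count.
  by_cases hF : 2 ≤ numBasicMet 3 (A ∩ cantorProd 3)
  · refine false_of_numBasicMet Set.inter_subset_right (by linarith)
      (fun x hx y hy => hdiam x hx.1 y hy.1) ?_ hF (by omega)
    rwa [cantorProb_inter]
  · obtain ⟨i, hi⟩ := subset_basicCube_of_numBasicMet_le_one (A := A ∩ cantorProd 3)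
      Set.inter_subset_right (by omega)
    obtain ⟨hD', h5'⟩ := magnify hD hdiam hmass hi
    have hj : ∃ j, j ≠ i ∧ (A ∩ basicCube 3 j).Nonempty := by
      by_contra! hj
      have : numBasicMet 3 A ≤ 1 := (Set.ncard_le_one_iff (Set.toFinite _)).2 fun {a b} ha hb => by
        have h : ∀ c, (A ∩ basicCube 3 c).Nonempty → c = i := fun c hc => by
          by_contra hne
          exact hc.ne_empty (hj c hne)
        rw [h a ha, h b hb]
      omega
    obtain ⟨j, hne, y, hyA, hy⟩ := hj
    obtain ⟨k, hk⟩ := Function.ne_iff.1 hne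
    -- In direction `k`, a subcube on the side away from `y` is at distance at least 1/3 + 2/9 = 5/9
    -- from `y`, more than `D`. Only the four subcubes on the near side can be met.
    have h4 : numBasicMet 3 (cantorMap 3 i ⁻¹' A ∩ cantorProd 3) ≤ 4 := by
      refine numBasicMet_le_four (k := k) (a := j k) ?_
      rintro v ⟨x, ⟨hxA, -⟩, hx⟩
      have h1 := (abs_sub_le_dist _ _ k).trans (hdiam _ hxA y hyA)
      rw [cantorMap_apply, abs_le] at h1
      obtain ⟨h2, h3⟩ := mem_basicCube_iff.1 hx k
      obtain ⟨h6, h7⟩ := mem_basicCube_iff.1 hy k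
      generalize v k = a at *
      generalize j k = b at *
      generalize i k = c at *
      fin_cases a <;> fin_cases b <;> fin_cases c <;>
        first | rfl | exact absurd rfl hk | (exfalso; norm_num at h1 h2 h3 h6 h7; linarith)
    omega

end Magnification

/-! ### Consequences for optimal sets -/

section Optimal

variable {A : Set (EuclideanSpace ℝ (Fin 3))} {i : Fin 3 → Fin 2}

theorem IsOptimalSet.rpow_diam_le (h : IsOptimalSet 3 A) :
    (Metric.ediam A).toReal ^ Real.logb 3 8 ≤
      testDiam ^ Real.logb 3 8 * (512 / 453 * (cantorProb A).toReal) :=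
  _root_.rpow_diam_le h.1 (h.2 testBall_mem_admissibleSets)

theorem IsOptimalSet.five_le_numBasicMet (h : IsOptimalSet 3 A) (h2 : 2 ≤ numBasicMet 3 A) :
    5 ≤ numBasicMet 3 A :=
  _root_.five_le_numBasicMet (third_le_diam_of_mem h.1)
    (fun _ hx _ hy => dist_le_diam_of_mem h.1 hx hy) h.rpow_diam_le h2

theorem convex_cantorMap_preimage (hA : Convex ℝ A) : Convex ℝ (cantorMap 3 i ⁻¹' A) := by
  intro x hx y hy a b ha hb hab
  have : cantorMap 3 i (a • x + b • y) = a • cantorMap 3 i x + b • cantorMap 3 i y := by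
    ext k
    simp only [cantorMap_apply, PiLp.add_apply, PiLp.smul_apply, smul_eq_mul]
    linear_combination (2 / 3 * ((i k : ℕ) : ℝ)) * (-hab)
  rw [Set.mem_preimage, this]
  exact hA hx hy ha hb hab

theorem IsOptimalSet.exists_magnification (h : IsOptimalSet 3 A) (h2 : numBasicMet 3 A < 2) :
    ∃ i, A ∩ cantorProd 3 ⊆ basicCube 3 i ∧ IsOptimalSet 3 (cantorMap 3 i ⁻¹' A) ∧
      5 ≤ numBasicMet 3 (cantorMap 3 i ⁻¹' A) := by
  have hmono := numBasicMet_mono (A := A ∩ cantorProd 3) (B := A) Set.inter_subset_left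
  obtain ⟨i, hi⟩ := subset_basicCube_of_numBasicMet_le_one (A := A ∩ cantorProd 3)
    Set.inter_subset_right (by omega)
  obtain ⟨hD, h5⟩ := magnify (third_le_diam_of_mem h.1)
    (fun _ hx _ hy => dist_le_diam_of_mem h.1 hx hy) h.rpow_diam_le hi
  refine ⟨i, hi, ⟨⟨convex_cantorMap_preimage h.1.1, ?_, ?_⟩, ?_⟩,
    h5.trans (numBasicMet_mono Set.inter_subset_left)⟩
  · rw [ediam_cantorMap_preimage]
    exact h.1.2.1.trans (le_mul_of_one_le_left' (by norm_num))
  · rw [ediam_cantorMap_preimage, ediam_cantorProd, ← ENNReal.ofReal_toReal (ediam_ne_top_of_mem h.1),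
      show (3 : ℝ≥0∞) = ENNReal.ofReal 3 by norm_num, ← ENNReal.ofReal_mul (by norm_num)]
    -- The magnified diameter is below 3 · 5/9 = 5/3, and 25/9 < 3.
    refine ENNReal.ofReal_le_ofReal (Real.le_sqrt_of_sq_le ?_)
    have := third_le_diam_of_mem h.1
    nlinarith
  · have heq : diamRatio 3 (cantorMap 3 i ⁻¹' A) = diamRatio 3 A := by
      rw [diamRatio_three, diamRatio_three, ediam_cantorMap_preimage, cantorProb_preimage hi,
        ENNReal.mul_rpow_of_nonneg _ _ logb_three_eight_pos.le]
      have h8 : (3 : ℝ≥0∞) ^ Real.logb 3 8 = 8 := by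
        have := three_pow_rpow_logb 1
        rw [pow_one, pow_one, ENNReal.inv_rpow, inv_inj] at this
        exact this
      rw [h8]
      exact ENNReal.mul_div_mul_left _ _ (by norm_num) (by norm_num)
    intro B hB
    rw [Set.mem_ofPred_eq, heq]
    exact h.2 hB

end Optimal

/-! ### Existence of an optimal set by compactness -/

section Existence

open Filter Topology

variable {X : Type*} [PseudoEMetricSpace X]

/-- The limits along an ultrafilter of sequences of points of the sets `A n`. -/
def ultraLimit (𝒰 : Ultrafilter ℕ) (A : ℕ → Set X) : Set X :=
  {x | ∃ a : ℕ → X, (∀ n, a n ∈ A n) ∧ Tendsto a 𝒰 (𝓝 x)}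

theorem exists_tendsto_mem_ultraLimit {𝒰 : Ultrafilter ℕ} {A : ℕ → Set X} {S : Set X}
    (hS : IsCompact S) (hA : ∀ n, A n ⊆ S) {a : ℕ → X} (ha : ∀ n, a n ∈ A n) :
    ∃ x ∈ ultraLimit 𝒰 A, Tendsto a 𝒰 (𝓝 x) := by
  obtain ⟨x, -, hx⟩ := hS.ultrafilter_le_nhds (𝒰.map a)
    (le_principal_iff.2 (mem_map.2 (univ_mem' fun n => hA n (ha n))))
  exact ⟨x, ⟨a, ha, hx⟩, hx⟩

/-- For the lower bound, pairs nearly realizing the diameters of the sets `A n` converge along `𝒰`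
to pairs in the limit set, by compactness. -/
theorem ediam_ultraLimit {𝒰 : Ultrafilter ℕ} {A : ℕ → Set X} {S : Set X} (hS : IsCompact S)
    (hA : ∀ n, A n ⊆ S) (hne : ∀ n, (A n).Nonempty) {δ : ℝ≥0∞}
    (hδ : Tendsto (fun n => Metric.ediam (A n)) 𝒰 (𝓝 δ)) :
    Metric.ediam (ultraLimit 𝒰 A) = δ := by
  refine le_antisymm (Metric.ediam_le ?_) (le_of_forall_lt fun r hr => ?_)
  · rintro x ⟨a, ha, hax⟩ y ⟨b, hb, hby⟩
    exact le_of_tendsto_of_tendsto (hax.edist hby) hδ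
      (.of_forall fun n => Metric.edist_le_ediam_of_mem (ha n) (hb n))
  · obtain ⟨q, hrq, hqδ⟩ := exists_between hr
    have key : ∀ n, ∃ p : X × X, p.1 ∈ A n ∧ p.2 ∈ A n ∧
        (q < Metric.ediam (A n) → q < edist p.1 p.2) := by
      intro n
      by_cases h : q < Metric.ediam (A n)
      · by_contra! hc
        refine h.not_ge (Metric.ediam_le fun x hx y hy => ?_)
        exact (hc (x, y) hx hy).2
      · obtain ⟨x, hx⟩ := hne n
        exact ⟨(x, x), hx, hx, fun h' => absurd h' h⟩
    choose p hp1 hp2 hp using key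
    obtain ⟨x, hx, hxl⟩ := exists_tendsto_mem_ultraLimit (𝒰 := 𝒰) hS hA hp1
    obtain ⟨y, hy, hyl⟩ := exists_tendsto_mem_ultraLimit (𝒰 := 𝒰) hS hA hp2
    have hq : q ≤ edist x y := ge_of_tendsto (hxl.edist hyl)
      ((hδ.eventually (lt_mem_nhds hqδ)).mono fun n hn => (hp n hn).le)
    exact hrq.trans_le (hq.trans (Metric.edist_le_ediam_of_mem hx hy))

/-- Choose in each `A n` a point outside the thickening whenever there is one. The chosen points
converge to a point of the limit set, so eventually they lie in the thickening, and no outside point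
existed. -/
theorem eventually_subset_thickening {𝒰 : Ultrafilter ℕ} {A : ℕ → Set X} {S : Set X}
    (hS : IsCompact S) (hA : ∀ n, A n ⊆ S) (hne : ∀ n, (A n).Nonempty) {ε : ℝ} (hε : 0 < ε) :
    ∀ᶠ n in 𝒰, A n ⊆ Metric.thickening ε (ultraLimit 𝒰 A) := by
  have key : ∀ n, ∃ a ∈ A n, a ∈ Metric.thickening ε (ultraLimit 𝒰 A) →
      A n ⊆ Metric.thickening ε (ultraLimit 𝒰 A) := by
    intro n
    by_cases h : A n ⊆ Metric.thickening ε (ultraLimit 𝒰 A)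
    · obtain ⟨x, hx⟩ := hne n
      exact ⟨x, hx, fun _ => h⟩
    · obtain ⟨x, hx, hx'⟩ := Set.not_subset.1 h
      exact ⟨x, hx, fun h' => absurd h' hx'⟩
  choose a ha hsub using key
  obtain ⟨x, hx, hxl⟩ := exists_tendsto_mem_ultraLimit (𝒰 := 𝒰) hS hA ha
  have hmem : Metric.thickening ε (ultraLimit 𝒰 A) ∈ 𝓝 x :=
    Metric.isOpen_thickening.mem_nhds (Metric.self_subset_thickening hε _ hx)
  exact (hxl.eventually hmem).mono fun n hn => hsub n hn

/-- Mass is upper semicontinuous: the closed thickenings eventually contain `A n`, and their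
measures tend to that of the closure. -/
theorem le_measure_closure_ultraLimit [MeasurableSpace X]
    [OpensMeasurableSpace X] (μ : Measure X) [IsFiniteMeasure μ]
    {𝒰 : Ultrafilter ℕ} {A : ℕ → Set X} {S : Set X}
    (hS : IsCompact S) (hA : ∀ n, A n ⊆ S) (hne : ∀ n, (A n).Nonempty) {m : ℝ≥0∞}
    (hm : Tendsto (fun n => μ (A n)) 𝒰 (𝓝 m)) : m ≤ μ (closure (ultraLimit 𝒰 A)) := by
  have hlim := tendsto_measure_cthickening (μ := μ) (s := ultraLimit 𝒰 A)
    ⟨1, one_pos, measure_ne_top _ _⟩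
  refine ge_of_tendsto (hlim.mono_left (nhdsWithin_le_nhds (s := Set.Ioi 0))) ?_
  filter_upwards [self_mem_nhdsWithin] with ε hε
  exact le_of_tendsto hm ((eventually_subset_thickening hS hA hne hε).mono fun n hn =>
    measure_mono (hn.trans (Metric.thickening_subset_cthickening _ _)))

theorem convex_ultraLimit {E : Type*} [NormedAddCommGroup E] [NormedSpace ℝ E]
    {𝒰 : Ultrafilter ℕ} {A : ℕ → Set E} (hA : ∀ n, Convex ℝ (A n)) :
    Convex ℝ (ultraLimit 𝒰 A) := by
  rintro x ⟨a, ha, hax⟩ y ⟨b, hb, hby⟩ s t hs ht hst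
  exact ⟨fun n => s • a n + t • b n, fun n => hA n (ha n) (hb n) hs ht hst,
    (hax.const_smul s).add (hby.const_smul t)⟩

/-- A finite quotient forces positive mass, hence a point of the dust; the diameter bound then
confines the set to a fixed compact ball. -/
theorem subset_closedBall_of_mem {A : Set (EuclideanSpace ℝ (Fin 3))} (hA : A ∈ admissibleSets 3)
    (h : diamRatio 3 A ≠ ∞) : A.Nonempty ∧ A ⊆ Metric.closedBall 0 (2 * √3) := by
  have hpos := cantorProb_pos_of_diamRatio hA h
  rw [← cantorProb_inter] at hpos
  obtain ⟨y, hyA, hyE⟩ : (A ∩ cantorProd 3).Nonempty := by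
    by_contra! hc
    rw [hc] at hpos
    simp at hpos
  refine ⟨⟨y, hyA⟩, fun x hx => ?_⟩
  have h1 := dist_le_diam_of_mem hA hx hyA
  have h2 : (Metric.ediam A).toReal ≤ √3 := by
    have := ENNReal.toReal_mono ediam_cantorProd_ne_top hA.2.2
    rwa [ediam_cantorProd, ENNReal.toReal_ofReal (Real.sqrt_nonneg _)] at this
  have h3 := dist_le_sqrt_three (cantorProd_subset_unitCube hyE)
    (cantorProd_subset_unitCube zero_mem_cantorProd)
  rw [Metric.mem_closedBall]
  linarith [dist_triangle x y 0]

theorem exists_isOptimalSet : ∃ A, IsOptimalSet 3 A := by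
  set V := diamRatio 3 '' admissibleSets 3 with hV
  have hVne : V.Nonempty := ⟨_, Set.mem_image_of_mem _ testBall_mem_admissibleSets⟩
  have hlt : sInf V < ∞ :=
    (sInf_le (Set.mem_image_of_mem _ testBall_mem_admissibleSets)).trans_lt
      (diamRatio_testBall_le.trans_lt ENNReal.ofReal_lt_top)
  obtain ⟨u, -, hu, huV⟩ := exists_seq_tendsto_sInf hVne (OrderBot.bddBelow V)
  obtain ⟨N, hN⟩ := eventually_atTop.1 (hu.eventually (gt_mem_nhds hlt))
  choose A hA hAu using fun n => huV (n + N)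
  have hfin : ∀ n, diamRatio 3 (A n) ≠ ∞ := fun n => by
    rw [hAu]; exact (hN _ (by omega)).ne
  -- Along an ultrafilter, diameters and masses converge in `ℝ≥0∞` without passing to subsequences.
  set 𝒰 : Ultrafilter ℕ := hyperfilter ℕ with h𝒰
  have hle : (𝒰 : Filter ℕ) ≤ atTop := by
    rw [← Nat.cofinite_eq_atTop]; exact hyperfilter_le_cofinite
  have hratio : Tendsto (fun n => diamRatio 3 (A n)) 𝒰 (𝓝 (sInf V)) := by
    simp only [hAu]
    exact ((tendsto_add_atTop_iff_nat N).2 hu).mono_left hle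
  have hS := isCompact_closedBall (0 : EuclideanSpace ℝ (Fin 3)) (2 * √3)
  have hAS := fun n => (subset_closedBall_of_mem (hA n) (hfin n)).2
  have hAne := fun n => (subset_closedBall_of_mem (hA n) (hfin n)).1
  have hconv : ∀ f : ℕ → ℝ≥0∞, ∃ l, Tendsto f 𝒰 (𝓝 l) := fun f => by
    obtain ⟨l, -, hl⟩ := isCompact_univ.ultrafilter_le_nhds (𝒰.map f) (by simp)
    exact ⟨l, hl⟩
  obtain ⟨δ, hδ⟩ := hconv fun n => Metric.ediam (A n)
  obtain ⟨m, hm⟩ := hconv fun n => cantorProb (A n)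
  set K := closure (ultraLimit 𝒰 A) with hK
  have hKdiam : Metric.ediam K = δ := by
    rw [hK, Metric.ediam_closure, ediam_ultraLimit hS hAS hAne hδ]
  have hKadm : K ∈ admissibleSets 3 := by
    refine ⟨(convex_ultraLimit fun n => (hA n).1).closure, ?_, ?_⟩ <;> rw [hKdiam]
    · exact ge_of_tendsto hδ (.of_forall fun n => (hA n).2.1)
    · exact le_of_tendsto hδ (.of_forall fun n => (hA n).2.2)
  have hδ0 : δ ≠ 0 := fun h0 => by
    have := third_le_diam_of_mem hKadm
    rw [hKdiam, h0] at this
    norm_num at this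
  have hδtop : δ ≠ ∞ := hKdiam ▸ ediam_ne_top_of_mem hKadm
  have hKm : m ≤ cantorProb K := le_measure_closure_ultraLimit cantorProb hS hAS hAne hm
  have hlim : Tendsto (fun n => diamRatio 3 (A n)) 𝒰 (𝓝 (δ ^ Real.logb 3 8 / m)) := by
    simp only [diamRatio_three]
    refine ENNReal.Tendsto.div (hδ.ennrpow_const _) (Or.inl ?_) hm (Or.inr ?_)
    · rw [Ne, ENNReal.rpow_eq_zero_iff_of_pos logb_three_eight_pos]
      exact hδ0
    · exact ENNReal.rpow_ne_top_of_nonneg logb_three_eight_pos.le hδtop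
  refine ⟨K, hKadm, fun B hB => ?_⟩
  rw [Set.mem_ofPred_eq]
  calc diamRatio 3 K = δ ^ Real.logb 3 8 / cantorProb K := by rw [diamRatio_three, hKdiam]
    _ ≤ δ ^ Real.logb 3 8 / m := ENNReal.div_le_div_left hKm _
    _ = sInf V := tendsto_nhds_unique hlim hratio
    _ ≤ diamRatio 3 B := sInf_le ⟨B, hB, rfl⟩

end Existence
theorem mainTheorem5 :
    (∃ A : Set (EuclideanSpace ℝ (Fin 3)), IsOptimalSet 3 A ∧ 5 ≤ numBasicMet 3 A) ∧
    (∀ A : Set (EuclideanSpace ℝ (Fin 3)), IsOptimalSet 3 A → 2 ≤ numBasicMet 3 A →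
      5 ≤ numBasicMet 3 A) ∧
    (∀ A : Set (EuclideanSpace ℝ (Fin 3)), IsOptimalSet 3 A → numBasicMet 3 A < 2 →
      ∃ i : Fin 3 → Fin 2, A ∩ cantorProd 3 ⊆ basicCube 3 i ∧
        IsOptimalSet 3 (cantorMap 3 i ⁻¹' A) ∧ 5 ≤ numBasicMet 3 (cantorMap 3 i ⁻¹' A)) := by
  refine ⟨?_, fun A hA h2 => hA.five_le_numBasicMet h2, fun A hA h2 => hA.exists_magnification h2⟩
  obtain ⟨A, hA⟩ := exists_isOptimalSet
  rcases lt_or_ge (numBasicMet 3 A) 2 with h | h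
  · obtain ⟨i, -, h1, h2⟩ := hA.exists_magnification h
    exact ⟨_, h1, h2⟩
  · exact ⟨A, hA, hA.five_le_numBasicMet h⟩
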